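/- All graphs are finite; loops, multiple edges and isolated vertices are allowed. A $\ast$-graph is a graph $G$ together with, at each vertex $v$, an unoriented cyclic order of the half-edges at $v$, i.e. a bijection, up to rotations and reflections, from the half-edges at $v$ to the vertices of a cycle graph $C_n$ ($C_1$ is a single vertex and $C_2$ a single edge; there is nothing to give if $v$ has no half-edges). Half-edges mapped to adjacent vertices are called adjacent. A $\ast$-graph is planar if there is a topological embedding of the underlying graph into $\mathbb R^2$ such that at each vertex $v$ the unoriented cyclic order in which the half-edges leave $v$ in the plane is the given one. The web graph $W(G)$ of a $\ast$-graph $G$ is the ordinary graph obtained from $G$ by placing one new vertex on each half-edge (so each edge of $G$ is subdivided into three edges) and joining by a new edge the new vertices on every two adjacent half-edges at the same vertex of $G$. Thus each vertex of $G$ of degree at least $3$ becomes the centre of a wheel whose rim is a cycle through the new vertices on its half-edges. Proposition. A $\ast$-graph $G$ is planar (compatibly with its cyclic orders) if and only if its web graph $W(G)$ is planar as an ordinary graph. -/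

import Mathlib

/-- A graph (loops, multiple edges and isolated vertices are allowed) presented by its half-edges:
`vert h` is the vertex to which the half-edge `h` is attached, and `opp h` is the other half of the
edge that contains `h`. The edges are the two-element sets `{h, opp h}`. -/
structure HalfEdgeGraph (V H : Type*) where
  vert : H → V
  opp : H → H
  opp_opp : ∀ h, opp (opp h) = h
  opp_ne : ∀ h, opp h ≠ h

/-- An embedding of a graph into the plane `ℝ² = ℂ`, i.e. an injective continuous map from the
topological realization of the graph (for a finite graph, this is a homeomorphism onto the image).
`arc h` is the image of the edge `{h, opp h}`, traversed from `vert h` to `vert (opp h)`. -/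
structure HalfEdgeGraph.PlaneEmbedding {V H : Type*} (G : HalfEdgeGraph V H) where
  point : V → ℂ
  arc : H → C(unitInterval, ℂ)
  arc_zero : ∀ h, arc h 0 = point (G.vert h)
  arc_opp : ∀ h t, arc (G.opp h) t = arc h (unitInterval.symm t)
  point_injective : Function.Injective point
  arc_ne_point : ∀ h v, ∀ t ∈ Set.Ioo (0 : unitInterval) 1, arc h t ≠ point v
  arc_inj : ∀ h k, ∀ s ∈ Set.Ioo (0 : unitInterval) 1, ∀ t ∈ Set.Ioo (0 : unitInterval) 1,
    arc h s = arc k t → (k = h ∧ t = s) ∨ (k = G.opp h ∧ t = unitInterval.symm s)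

/-- Planarity of an ordinary graph. -/
def HalfEdgeGraph.IsPlanar {V H : Type*} (G : HalfEdgeGraph V H) : Prop :=
  Nonempty G.PlaneEmbedding

/-- The half-edges at `v`, indexed by `0, …, n - 1` through the bijection `φ`, leave the point `v`
in the cyclic order `0, 1, …, n - 1` (in one of the two directions of rotation): a homeomorphism
`Φ` of a neighbourhood of the point `v` onto a neighbourhood of `0` makes their initial parts run
along the rays from `0` of angles `0 ≤ θ 0 < θ 1 < ⋯ < θ (n - 1) < 2 π`. -/
def HalfEdgeGraph.PlaneEmbedding.LeaveInCyclicOrder {V H : Type*} {G : HalfEdgeGraph V H}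
    (D : G.PlaneEmbedding) (v : V) {n : ℕ} (φ : {h : H // G.vert h = v} ≃ Fin n) : Prop :=
  ∃ (Φ : OpenPartialHomeomorph ℂ ℂ) (θ : Fin n → ℝ),
    D.point v ∈ Φ.source ∧ Φ (D.point v) = 0 ∧
    StrictMono θ ∧ (∀ i, θ i ∈ Set.Ico 0 (2 * Real.pi)) ∧
    ∀ h : {h : H // G.vert h = v}, ∀ᶠ t in nhdsWithin (0 : unitInterval) (Set.Ioi 0),
      D.arc h t ∈ Φ.source ∧
      ∃ r : ℝ, 0 < r ∧ Φ (D.arc h t) = (r : ℂ) * Complex.exp ((θ (φ h) : ℂ) * Complex.I)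

/-- A `∗`-graph: a graph with an unoriented cyclic order of the half-edges at each vertex. The order
at `v` is recorded by its adjacency relation `adj v`, which is to correspond to that of a cycle graph
under some bijection from the half-edges at `v` to the vertices of the cycle graph. (Two bijections
give the same relation if and only if they differ by a rotation or reflection.) -/
structure StarGraph (V H : Type*) extends HalfEdgeGraph V H where
  adj : (v : V) → SimpleGraph {h : H // vert h = v}
  adj_cycle : ∀ v, ∃ n : ℕ, Nonempty (adj v ≃g SimpleGraph.cycleGraph n)

/-- A plane embedding is compatible with the `∗`-structure: at every vertex the unoriented cyclic
order induced by the embedding is the given one. -/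
def StarGraph.IsCompatible {V H : Type*} (G : StarGraph V H)
    (D : G.toHalfEdgeGraph.PlaneEmbedding) : Prop :=
  ∀ v, ∃ (n : ℕ) (φ : G.adj v ≃g SimpleGraph.cycleGraph n), D.LeaveInCyclicOrder v φ.toEquiv

/-- Planarity of a `∗`-graph. -/
def StarGraph.IsPlanar {V H : Type*} (G : StarGraph V H) : Prop :=
  ∃ D : G.toHalfEdgeGraph.PlaneEmbedding, G.IsCompatible D

/-- The half-edges of the web graph. Its vertices are the old vertices `v` (the centres of the webs)
and one new vertex for each old half-edge `h`. Its edges are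
* the spokes `{out h, into h}`, joining the centre `vert h` to the new vertex on `h`;
* the middle parts `{mid h, mid (opp h)}` of the old edges, joining the new vertices on `h` and on
  `opp h`;
* the rim edges, one for each pair of adjacent half-edges at a vertex `v`, joining the two new
  vertices on them (a dart is an edge of `adj v` with a direction). -/
inductive StarGraph.WebHalfEdge {V H : Type*} (G : StarGraph V H)
  | out (h : H)
  | into (h : H)
  | mid (h : H)
  | rim (v : V) (d : (G.adj v).Dart)

/-- The vertex of the web graph to which a half-edge is attached. -/
def StarGraph.webVert {V H : Type*} (G : StarGraph V H) : G.WebHalfEdge → V ⊕ H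
  | .out h => .inl (G.vert h)
  | .into h => .inr h
  | .mid h => .inr h
  | .rim _ d => .inr d.fst

/-- The other half of an edge of the web graph. -/
def StarGraph.webOpp {V H : Type*} (G : StarGraph V H) : G.WebHalfEdge → G.WebHalfEdge
  | .out h => .into h
  | .into h => .out h
  | .mid h => .mid (G.opp h)
  | .rim v d => .rim v d.symm

/-- The web graph of a `∗`-graph, as an ordinary graph. -/
def StarGraph.web {V H : Type*} (G : StarGraph V H) : HalfEdgeGraph (V ⊕ H) G.WebHalfEdge where
  vert := G.webVert
  opp := G.webOpp
  opp_opp := by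
    rintro (h | h | h | ⟨v, d⟩) <;> simp [StarGraph.webOpp, G.opp_opp]
  opp_ne := by
    rintro (h | h | h | ⟨v, d⟩) <;> simp [StarGraph.webOpp, G.opp_ne, SimpleGraph.Dart.symm_ne]

/-!
The passage between a compatible drawing of a `∗`-graph and a drawing of its web graph rests on the
following observations. A plane drawing is described throughout by its *arms*, the halves of its
edges (`HalfEdgeGraph.ArmEmbedding`).

*From the graph to the web.* In the local picture at a vertex `v` the half-edges at `v` begin with
pieces of rays. A small circle in this picture meets the drawing exactly once on each half-edge at
`v` and nowhere else (`HalfEdgeGraph.PlaneEmbedding.LeaveInCyclicOrder.exists_circle`). The new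
vertices are placed at these points, and the rim edges are the arcs of the circle between
consecutive points (`StarGraph.VertexCircles.webEmbedding`).

*From the web to the graph.* A drawing of the web graph may be wild near a vertex, but it can be
changed so that all edges start with straight segments
(`HalfEdgeGraph.ArmEmbedding.exists_straight`): before its last visit to a small disc around the
vertex, each arm is replaced by a radius. Forgetting the rims leaves a drawing of the graph
(`StarGraph.merge`), and the half-edges at `v` leave along rays, so it remains to see that their
order by angle is the given one. Suppose that half-edges `a` and `b`,
adjacent in the given order, are separated at `v` by half-edges `k` and `l`. Outside a disc around
`v`, the spokes of `a` and `b` are connected through a rim edge, and those of `k` and `l` are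
connected through the rest of the rim, because a cycle without two adjacent vertices is connected
(`SimpleGraph.cycleGraph_rel_of_adj`). The two connections are disjoint, but their end points on the
circle are interlaced, which is impossible (`not_disjoint_of_joinedIn_of_interlaced`). So every
adjacency of the given order is one of the order by angle, and both have equally many.

The last impossibility is the only fact of plane topology that is needed. After an inversion it says
that two curves `γ`, `δ` in the closed disc with interlaced end points on the circle meet. Otherwise
`γ s - δ t` has a continuous logarithm on the plane, since `exp` is a covering map, while its
changes along the sides of the unit square can be computed and add up to `-2πi`, not to `0`.
-/

/-! ### Curves with interlaced end points -/

/-- A continuous logarithm of `c * (1 - w t)`, with `w` in the closed unit disc, changes in the same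
way as the principal logarithm of `1 - w t`, because `1 - w t` stays in the right half plane. -/
theorem continuousLog_sub_eq_log_sub {g w : ℝ → ℂ} {c : ℂ} (hg : Continuous g) (hw : Continuous w)
    (hw1 : ∀ t, ‖w t‖ ≤ 1) (hwne : ∀ t, w t ≠ 1)
    (h : ∀ t, Complex.exp (g t) = c * (1 - w t)) (a b : ℝ) :
    g b - g a = Complex.log (1 - w b) - Complex.log (1 - w a) := by
  have hre : ∀ t, 0 < (1 - w t).re := by
    intro t
    have h1 : (w t).re ≤ ‖w t‖ := Complex.re_le_norm _
    have h3 : (w t).re ≠ 1 := by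
      intro h4
      apply hwne t
      have h5 : (w t).re ^ 2 + (w t).im ^ 2 ≤ 1 := by
        have := Complex.sq_norm (w t)
        rw [Complex.normSq_apply] at this
        nlinarith [hw1 t, norm_nonneg (w t)]
      have h6 : (w t).im = 0 := by
        rw [h4] at h5
        nlinarith [sq_nonneg (w t).im]
      exact Complex.ext h4 h6
    have h7 : (w t).re < 1 := lt_of_le_of_ne (h1.trans (hw1 t)) h3
    simpa using h7
  have hcont : Continuous fun t => g t - Complex.log (1 - w t) :=
    hg.sub ((continuous_const.sub hw).clog fun t => Or.inl (hre t))
  have hne : ∀ t, 1 - w t ≠ 0 := fun t => sub_ne_zero.2 (hwne t).symm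
  have hconst := Complex.isCoveringMap_exp.const_of_comp hcont (fun s t => by
    apply Subtype.ext
    simp only [Complex.exp_sub, h, Complex.exp_log (hne _)]
    rw [mul_div_assoc, mul_div_assoc, div_self (hne _), div_self (hne _)]) b a
  linear_combination hconst

theorem exp_ofReal_add_two_pi_mul_I (x : ℝ) :
    Complex.exp ((x + 2 * Real.pi : ℝ) * Complex.I) = Complex.exp (x * Complex.I) := by
  rw [← Complex.exp_periodic ((x : ℂ) * Complex.I)]
  congr 1
  push_cast
  ring

theorem arg_one_sub_exp_mul_I {φ : ℝ} (h0 : 0 < φ) (h1 : φ < 2 * Real.pi) :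
    (1 - Complex.exp (φ * Complex.I)).arg = (φ - Real.pi) / 2 := by
  have hs : 0 < Real.sin (φ / 2) := Real.sin_pos_of_pos_of_lt_pi (by linarith) (by linarith)
  have key : 1 - Complex.exp (φ * Complex.I) = ((2 * Real.sin (φ / 2) : ℝ) : ℂ) *
      (Complex.cos (((φ - Real.pi) / 2 : ℝ) : ℂ) +
        Complex.sin (((φ - Real.pi) / 2 : ℝ) : ℂ) * Complex.I) := by
    have e1 : (φ - Real.pi) / 2 = φ / 2 - Real.pi / 2 := by ring
    have hc : Real.cos φ = 1 - 2 * Real.sin (φ / 2) ^ 2 := by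
      have := Real.cos_sq (φ / 2)
      have h2 := Real.sin_sq_add_cos_sq (φ / 2)
      rw [show 2 * (φ / 2) = φ by ring] at this
      linarith
    have hsn : Real.sin φ = 2 * Real.sin (φ / 2) * Real.cos (φ / 2) := by
      rw [← Real.sin_two_mul]; congr 1; ring
    rw [e1, Complex.exp_mul_I, ← Complex.ofReal_cos, ← Complex.ofReal_sin, ← Complex.ofReal_cos,
      ← Complex.ofReal_sin, Real.cos_sub_pi_div_two, Real.sin_sub_pi_div_two, hc, hsn]
    push_cast
    ring
  rw [key, Complex.arg_mul_cos_add_sin_mul_I (by positivity) ⟨by linarith, by linarith⟩]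

/-- Two curves in the closed unit disc whose end points on the unit circle are interlaced meet.
Otherwise the difference `γ s - δ t` would have a continuous logarithm on the plane; its changes
along the four sides of the unit square are given by `arg_one_sub_exp_mul_I`, and they do not add up
to zero. -/
theorem exists_eq_of_interlaced_disc {γ δ : ℝ → ℂ} (hγ : Continuous γ) (hδ : Continuous δ)
    (hγ1 : ∀ s, ‖γ s‖ ≤ 1) (hδ1 : ∀ s, ‖δ s‖ ≤ 1) {α κ β μ : ℝ} (h1 : α < κ) (h2 : κ < β)
    (h3 : β < μ) (h4 : μ < α + 2 * Real.pi)
    (hγa : γ 0 = Complex.exp (α * Complex.I)) (hγb : γ 1 = Complex.exp (β * Complex.I))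
    (hδa : δ 0 = Complex.exp (κ * Complex.I)) (hδb : δ 1 = Complex.exp (μ * Complex.I)) :
    ∃ s t, γ s = δ t := by
  by_contra! hne
  -- `ℝ × ℝ` is simply connected, so the difference lifts through `exp`
  let f : C(ℝ × ℝ, {z : ℂ // z ≠ 0}) :=
    ⟨fun p => ⟨γ p.1 - δ p.2, sub_ne_zero.2 (hne _ _)⟩, by fun_prop⟩
  obtain ⟨z0, hz0⟩ : ∃ z0 : ℂ, (⟨_, z0.exp_ne_zero⟩ : {z : ℂ // z ≠ 0}) = f (0, 0) :=
    ⟨Complex.log (f (0, 0)).1, Subtype.ext (Complex.exp_log (f (0, 0)).2)⟩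
  obtain ⟨g, ⟨-, hg⟩, -⟩ :=
    Complex.isCoveringMap_exp.existsUnique_continuousMap_lifts f (0, 0) z0 hz0
  have hexp : ∀ s t, Complex.exp (g (s, t)) = γ s - δ t := by
    intro s t
    have := congrFun hg (s, t)
    exact congrArg Subtype.val this
  have hnorm : ∀ x : ℝ, ‖Complex.exp (x * Complex.I)‖ = 1 := Complex.norm_exp_ofReal_mul_I
  have side1 : ∀ (s x : ℝ), γ s = Complex.exp (x * Complex.I) →
      g (s, 1) - g (s, 0) = Complex.log (1 - δ 1 / γ s) - Complex.log (1 - δ 0 / γ s) := by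
    intro s x hx
    have hx0 : γ s ≠ 0 := hx ▸ Complex.exp_ne_zero _
    refine continuousLog_sub_eq_log_sub (g := fun t => g (s, t)) (w := fun t => δ t / γ s)
      (c := γ s) (by fun_prop) (by fun_prop) ?_ ?_ ?_ 0 1
    · intro t
      rw [norm_div, hx, hnorm, div_one]
      exact hδ1 t
    · intro t h
      rw [div_eq_one_iff_eq hx0] at h
      exact hne s t h.symm
    · intro t
      rw [hexp]
      field_simp
  have side2 : ∀ (t x : ℝ), δ t = Complex.exp (x * Complex.I) →
      g (1, t) - g (0, t) = Complex.log (1 - γ 1 / δ t) - Complex.log (1 - γ 0 / δ t) := by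
    intro t x hx
    have hx0 : δ t ≠ 0 := hx ▸ Complex.exp_ne_zero _
    refine continuousLog_sub_eq_log_sub (g := fun s => g (s, t)) (w := fun s => γ s / δ t)
      (c := -δ t) (by fun_prop) (by fun_prop) ?_ ?_ ?_ 0 1
    · intro s
      rw [norm_div, hx, hnorm, div_one]
      exact hγ1 s
    · intro s h
      rw [div_eq_one_iff_eq hx0] at h
      exact hne s t h
    · intro s
      rw [hexp]
      field_simp
      ring
  have s1 := congrArg Complex.im (side1 0 α hγa)
  have s2 := congrArg Complex.im (side1 1 β hγb)
  have s3 := congrArg Complex.im (side2 0 κ hδa)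
  have s4 := congrArg Complex.im (side2 1 μ hδb)
  have hquot : ∀ x y : ℝ, Complex.exp (x * Complex.I) / Complex.exp (y * Complex.I) =
      Complex.exp ((x - y : ℝ) * Complex.I) := by
    intro x y
    rw [← Complex.exp_sub]
    congr 1
    push_cast
    ring
  -- reduce the arguments of all exponentials to `(0, 2π)`
  simp only [Complex.sub_im, Complex.log_im, hγa, hγb, hδa, hδb, hquot] at s1 s2 s3 s4
  rw [arg_one_sub_exp_mul_I (φ := μ - α) (by linarith) (by linarith),
    arg_one_sub_exp_mul_I (φ := κ - α) (by linarith) (by linarith)] at s1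
  rw [arg_one_sub_exp_mul_I (φ := μ - β) (by linarith) (by linarith),
    ← exp_ofReal_add_two_pi_mul_I (κ - β),
    arg_one_sub_exp_mul_I (φ := κ - β + 2 * Real.pi) (by linarith) (by linarith)] at s2
  rw [arg_one_sub_exp_mul_I (φ := β - κ) (by linarith) (by linarith),
    ← exp_ofReal_add_two_pi_mul_I (α - κ),
    arg_one_sub_exp_mul_I (φ := α - κ + 2 * Real.pi) (by linarith) (by linarith)] at s3
  rw [← exp_ofReal_add_two_pi_mul_I (β - μ),
    arg_one_sub_exp_mul_I (φ := β - μ + 2 * Real.pi) (by linarith) (by linarith),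
    ← exp_ofReal_add_two_pi_mul_I (α - μ),
    arg_one_sub_exp_mul_I (φ := α - μ + 2 * Real.pi) (by linarith) (by linarith)] at s4
  have := Real.pi_pos
  linarith

/-- Outside an open disc, disjoint sets cannot join interlaced pairs of points of the bounding
circle: the inversion in the circle reduces this to `exists_eq_of_interlaced_disc`. -/
theorem not_disjoint_of_joinedIn_of_interlaced {p : ℂ} {r : ℝ} (hr : 0 < r) {A B : Set ℂ}
    (hA : ∀ z ∈ A, r ≤ dist z p) (hB : ∀ z ∈ B, r ≤ dist z p) {α κ β μ : ℝ} (h1 : α < κ)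
    (h2 : κ < β) (h3 : β < μ) (h4 : μ < α + 2 * Real.pi)
    (hγ : JoinedIn A (p + r * Complex.exp (α * Complex.I)) (p + r * Complex.exp (β * Complex.I)))
    (hδ : JoinedIn B (p + r * Complex.exp (κ * Complex.I)) (p + r * Complex.exp (μ * Complex.I))) :
    ¬ Disjoint A B := by
  intro hAB
  obtain ⟨γ, hγA⟩ := hγ
  obtain ⟨δ, hδB⟩ := hδ
  have hγE : ∀ s, γ.extend s ∈ A := fun s => hγA _
  have hδE : ∀ s, δ.extend s ∈ B := fun s => hδB _
  -- the inversion
  let F : ℂ → ℂ := fun z => (starRingEnd ℂ) (r / (z - p))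
  have hF1 : ∀ z, r ≤ dist z p → ‖F z‖ ≤ 1 := by
    intro z hz
    simp only [F, RCLike.norm_conj, norm_div, Complex.norm_real, Real.norm_eq_abs, abs_of_pos hr]
    rw [← dist_eq_norm]
    exact (div_le_one (hr.trans_le hz)).2 hz
  have hne : ∀ z, r ≤ dist z p → z - p ≠ 0 := by
    intro z hz h
    rw [dist_eq_norm, h, norm_zero] at hz
    linarith
  have hF2 : ∀ x : ℝ, F (p + r * Complex.exp (x * Complex.I)) = Complex.exp (x * Complex.I) := by
    intro x
    have : (r : ℂ) ≠ 0 := by exact_mod_cast hr.ne'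
    simp only [F, add_sub_cancel_left]
    rw [div_mul_cancel_left₀ this, ← Complex.exp_neg, ← Complex.exp_conj]
    congr 1
    simp
  have hF3 : ∀ ε : ℝ → ℂ, Continuous ε → (∀ s, r ≤ dist (ε s) p) → Continuous fun s => F (ε s) := by
    intro ε hε h
    exact Complex.continuous_conj.comp (continuous_const.div (hε.sub continuous_const)
      fun s => hne _ (h s))
  obtain ⟨s, t, hst⟩ := exists_eq_of_interlaced_disc
    (hF3 _ γ.continuous_extend fun s => hA _ (hγE s))
    (hF3 _ δ.continuous_extend fun s => hB _ (hδE s))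
    (fun s => hF1 _ (hA _ (hγE s))) (fun s => hF1 _ (hB _ (hδE s))) h1 h2 h3 h4
    (by simp [hF2]) (by simp [hF2]) (by simp [hF2]) (by simp [hF2])
  have hrc : (r : ℂ) ≠ 0 := by exact_mod_cast hr.ne'
  have h5 := (starRingEnd ℂ).injective hst
  rw [div_eq_div_iff (hne _ (hA _ (hγE s))) (hne _ (hB _ (hδE t)))] at h5
  have h6 : γ.extend s = δ.extend t := (sub_left_inj.1 (mul_left_cancel₀ hrc h5)).symm
  exact Set.disjoint_left.1 hAB (hγE s) (h6 ▸ hδE t)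

/-! ### Drawings described by half-edges -/

theorem HalfEdgeGraph.opp_injective {V H : Type*} (G : HalfEdgeGraph V H) :
    Function.Injective G.opp :=
  Function.LeftInverse.injective G.opp_opp

/-- A plane embedding described by its half-edges: `arm h` runs from the vertex `vert h`, at time
`0`, to the middle of the edge `{h, opp h}`, at time `1`. The values of `arm h` at other times are
irrelevant; they are there so that continuity can be stated on the whole line. -/
structure HalfEdgeGraph.ArmEmbedding {V H : Type*} (G : HalfEdgeGraph V H) where
  point : V → ℂ
  arm : H → ℝ → ℂ
  continuous_arm : ∀ h, Continuous (arm h)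
  arm_zero : ∀ h, arm h 0 = point (G.vert h)
  arm_opp_one : ∀ h, arm (G.opp h) 1 = arm h 1
  point_injective : Function.Injective point
  arm_ne_point : ∀ h v, ∀ t ∈ Set.Ioc (0 : ℝ) 1, arm h t ≠ point v
  arm_inj : ∀ h k, ∀ s ∈ Set.Ioc (0 : ℝ) 1, ∀ t ∈ Set.Ioc (0 : ℝ) 1,
    arm h s = arm k t → t = s ∧ (k = h ∨ (k = G.opp h ∧ s = 1))

namespace HalfEdgeGraph

variable {V H : Type*} {G : HalfEdgeGraph V H}

/-- The arms of a plane embedding are the first halves of its arcs. -/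
noncomputable def PlaneEmbedding.toArmEmbedding (D : G.PlaneEmbedding) : G.ArmEmbedding where
  point := D.point
  arm h t := D.arc h (Set.projIcc 0 1 zero_le_one (t / 2))
  continuous_arm h :=
    (D.arc h).continuous.comp (continuous_projIcc.comp (continuous_id.div_const 2))
  arm_zero h := by
    rw [zero_div, Set.projIcc_left]
    exact D.arc_zero h
  arm_opp_one h := by
    rw [D.arc_opp]
    congr 1
    apply Subtype.ext
    rw [Set.projIcc_of_mem zero_le_one (show (1 / 2 : ℝ) ∈ Set.Icc 0 1 by norm_num)]
    norm_num [unitInterval.coe_symm_eq]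
  point_injective := D.point_injective
  arm_ne_point h v t ht := by
    apply D.arc_ne_point
    rw [Set.projIcc_of_mem zero_le_one ⟨by linarith [ht.1], by linarith [ht.2]⟩]
    constructor
    · exact Subtype.mk_lt_mk.2 (by linarith [ht.1])
    · exact Subtype.mk_lt_mk.2 (by linarith [ht.2])
  arm_inj h k s hs t ht heq := by
    rw [Set.projIcc_of_mem zero_le_one ⟨by linarith [hs.1], by linarith [hs.2]⟩,
      Set.projIcc_of_mem zero_le_one ⟨by linarith [ht.1], by linarith [ht.2]⟩] at heq
    have := D.arc_inj h k _ ⟨Subtype.mk_lt_mk.2 (by linarith [hs.1]),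
      Subtype.mk_lt_mk.2 (by linarith [hs.2])⟩ _ ⟨Subtype.mk_lt_mk.2 (by linarith [ht.1]),
      Subtype.mk_lt_mk.2 (by linarith [ht.2])⟩ heq
    rcases this with ⟨hk, hts⟩ | ⟨hk, hts⟩
    · have h1 := congrArg Subtype.val hts
      simp only at h1
      exact ⟨by linarith, Or.inl hk⟩
    · have h1 := congrArg Subtype.val hts
      simp only [unitInterval.coe_symm_eq] at h1
      have h2 := hs.2
      have h3 := ht.2
      exact ⟨by linarith, Or.inr ⟨hk, by linarith⟩⟩

namespace ArmEmbedding

/-- The arc of an edge, in terms of the arms of its two halves. -/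
noncomputable def arc (E : G.ArmEmbedding) (h : H) : C(unitInterval, ℂ) where
  toFun t := if (t : ℝ) ≤ 1 / 2 then E.arm h (2 * t) else E.arm (G.opp h) (2 - 2 * t)
  continuous_toFun := by
    have h1 := E.continuous_arm h
    have h2 := E.continuous_arm (G.opp h)
    refine Continuous.if_le (by fun_prop) (by fun_prop) (by fun_prop) (by fun_prop) ?_
    intro t ht
    rw [ht]
    norm_num
    exact (E.arm_opp_one h).symm

theorem arc_of_le (E : G.ArmEmbedding) (h : H) {t : unitInterval} (ht : (t : ℝ) ≤ 1 / 2) :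
    E.arc h t = E.arm h (2 * t) := if_pos ht

theorem arc_of_ge (E : G.ArmEmbedding) (h : H) {t : unitInterval} (ht : 1 / 2 ≤ (t : ℝ)) :
    E.arc h t = E.arm (G.opp h) (2 - 2 * t) := by
  rcases ht.eq_or_lt with h1 | h1
  · rw [E.arc_of_le h h1.ge, ← h1]
    norm_num
    exact (E.arm_opp_one h).symm
  · exact if_neg h1.not_ge

/-- The plane embedding with given arms. -/
noncomputable def toPlaneEmbedding (E : G.ArmEmbedding) : G.PlaneEmbedding where
  point := E.point
  arc := E.arc
  arc_zero h := by
    rw [E.arc_of_le h (by simp)]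
    simpa using E.arm_zero h
  arc_opp h t := by
    rcases le_total (t : ℝ) (1 / 2) with ht | ht
    · rw [E.arc_of_le _ ht, E.arc_of_ge h (by rw [unitInterval.coe_symm_eq]; linarith),
        unitInterval.coe_symm_eq]
      congr 1
      ring
    · rw [E.arc_of_ge _ ht, E.arc_of_le h (by rw [unitInterval.coe_symm_eq]; linarith),
        unitInterval.coe_symm_eq, G.opp_opp]
      congr 1
      ring
  point_injective := E.point_injective
  arc_ne_point h v t ht := by
    have h0 : (0 : ℝ) < t := ht.1
    have h1 : (t : ℝ) < 1 := ht.2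
    rcases le_total (t : ℝ) (1 / 2) with h2 | h2
    · rw [E.arc_of_le _ h2]
      exact E.arm_ne_point _ _ _ ⟨by linarith, by linarith⟩
    · rw [E.arc_of_ge _ h2]
      exact E.arm_ne_point _ _ _ ⟨by linarith, by linarith⟩
  arc_inj h k s hs t ht heq := by
    have h0 : (0 : ℝ) < s := hs.1
    have h1 : (s : ℝ) < 1 := hs.2
    have h0' : (0 : ℝ) < t := ht.1
    have h1' : (t : ℝ) < 1 := ht.2
    rcases le_total (s : ℝ) (1 / 2) with h2 | h2 <;> rcases le_total (t : ℝ) (1 / 2) with h3 | h3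
    · rw [E.arc_of_le _ h2, E.arc_of_le _ h3] at heq
      obtain ⟨e1, e2⟩ := E.arm_inj _ _ _ ⟨by linarith, by linarith⟩ _
        ⟨by linarith, by linarith⟩ heq
      rcases e2 with e2 | ⟨e2, e3⟩
      · exact Or.inl ⟨e2, Subtype.ext (by linarith)⟩
      · exact Or.inr ⟨e2, Subtype.ext (by rw [unitInterval.coe_symm_eq]; linarith)⟩
    · rw [E.arc_of_le _ h2, E.arc_of_ge _ h3] at heq
      obtain ⟨e1, e2⟩ := E.arm_inj _ _ _ ⟨by linarith, by linarith⟩ _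
        ⟨by linarith, by linarith⟩ heq
      rcases e2 with e2 | ⟨e2, e3⟩
      · exact Or.inr ⟨by rw [← e2, G.opp_opp],
          Subtype.ext (by rw [unitInterval.coe_symm_eq]; linarith)⟩
      · exact Or.inl ⟨G.opp_injective e2, Subtype.ext (by linarith)⟩
    · rw [E.arc_of_ge _ h2, E.arc_of_le _ h3] at heq
      obtain ⟨e1, e2⟩ := E.arm_inj _ _ _ ⟨by linarith, by linarith⟩ _
        ⟨by linarith, by linarith⟩ heq
      rcases e2 with e2 | ⟨e2, e3⟩
      · exact Or.inr ⟨e2, Subtype.ext (by rw [unitInterval.coe_symm_eq]; linarith)⟩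
      · exact Or.inl ⟨by rw [e2, G.opp_opp], Subtype.ext (by linarith)⟩
    · rw [E.arc_of_ge _ h2, E.arc_of_ge _ h3] at heq
      obtain ⟨e1, e2⟩ := E.arm_inj _ _ _ ⟨by linarith, by linarith⟩ _
        ⟨by linarith, by linarith⟩ heq
      rcases e2 with e2 | ⟨e2, e3⟩
      · exact Or.inl ⟨G.opp_injective e2, Subtype.ext (by linarith)⟩
      · exact Or.inr ⟨G.opp_injective e2,
          Subtype.ext (by rw [unitInterval.coe_symm_eq]; linarith)⟩

/-- The part of the plane drawing formed by the vertices in `Z` and the half-edges in `Y`. -/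
def body (E : G.ArmEmbedding) (Y : Set H) (Z : Set V) : Set ℂ :=
  E.point '' Z ∪ {z | ∃ h ∈ Y, ∃ t ∈ Set.Ioc (0 : ℝ) 1, E.arm h t = z}

theorem disjoint_body (E : G.ArmEmbedding) {Y Y' : Set H} {Z Z' : Set V}
    (hY : ∀ h ∈ Y, G.opp h ∈ Y) (hYY : Disjoint Y Y') (hZZ : Disjoint Z Z') :
    Disjoint (E.body Y Z) (E.body Y' Z') := by
  rw [Set.disjoint_left]
  rintro _ (⟨v, hv, rfl⟩ | ⟨h, hh, t, ht, rfl⟩) (⟨w, hw, e⟩ | ⟨k, hk, s, hs, e⟩)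
  · exact Set.disjoint_left.1 hZZ hv (E.point_injective e ▸ hw)
  · exact E.arm_ne_point k v s hs e
  · exact E.arm_ne_point h w t ht e.symm
  · rcases (E.arm_inj h k t ht s hs e.symm).2 with rfl | ⟨rfl, -⟩
    · exact Set.disjoint_left.1 hYY hh hk
    · exact Set.disjoint_left.1 hYY (hY _ hh) hk

end ArmEmbedding

end HalfEdgeGraph

/-! ### Straightening a drawing near its vertices -/

open Filter Topology in
theorem IsCompact.eventually_lt_dist {K : Set ℂ} (hK : IsCompact K) {p : ℂ} (hp : p ∉ K) :
    ∀ᶠ r : ℝ in 𝓝[>] 0, ∀ z ∈ K, r < dist z p := by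
  obtain ⟨ε, hε, h⟩ := Metric.isOpen_iff.1 hK.isClosed.isOpen_compl p hp
  filter_upwards [Ioo_mem_nhdsGT hε] with r hr z hz
  by_contra! hlt
  exact h (Metric.mem_ball.2 (hlt.trans_lt hr.2)) hz

/-- The last time at which a curve that starts at `p` is at distance `r` from `p`. -/
theorem exists_last_time_dist_eq {γ : ℝ → ℂ} (hγ : Continuous γ) {p : ℂ} (h0 : γ 0 = p) {r : ℝ}
    (hr : 0 < r) (h1 : r < dist (γ 1) p) :
    ∃ a ∈ Set.Ioo (0 : ℝ) 1, dist (γ a) p = r ∧ ∀ t ∈ Set.Ioc a 1, r < dist (γ t) p := by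
  have hd : Continuous fun t => dist (γ t) p := hγ.dist continuous_const
  have hcpt : IsCompact (Set.Icc (0 : ℝ) 1 ∩ {t | dist (γ t) p ≤ r}) :=
    isCompact_Icc.inter_right (isClosed_le hd continuous_const)
  obtain ⟨a, ⟨ha1, ha2⟩, hmax⟩ := hcpt.exists_isGreatest
    ⟨0, ⟨le_rfl, zero_le_one⟩, by simpa [h0] using hr.le⟩
  have hlt : a < 1 := lt_of_le_of_ne ha1.2 (by rintro rfl; exact absurd ha2 h1.not_ge)
  have hgt : ∀ t ∈ Set.Ioc a 1, r < dist (γ t) p := by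
    intro t ht
    by_contra! hle
    exact absurd (hmax ⟨⟨ha1.1.trans ht.1.le, ht.2⟩, hle⟩) ht.1.not_ge
  have hge : r ≤ dist (γ a) p := by
    have hsub : closure (Set.Ioc a 1) ⊆ {t | r ≤ dist (γ t) p} :=
      closure_minimal (fun t ht => (hgt t ht).le) (isClosed_le continuous_const hd)
    rw [closure_Ioc hlt.ne] at hsub
    exact hsub ⟨le_rfl, hlt.le⟩
  have hda : dist (γ a) p = r := le_antisymm ha2 hge
  refine ⟨a, ⟨lt_of_le_of_ne ha1.1 ?_, hlt⟩, hda, hgt⟩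
  rintro rfl
  rw [h0, dist_self] at hda
  exact hr.ne hda

namespace HalfEdgeGraph.ArmEmbedding

variable {V H : Type*} {G : HalfEdgeGraph V H}

open Filter Topology in
/-- Every plane embedding of a finite graph can be changed so that, for some `r > 0`, the part of
the drawing in the disc of radius `r` around a vertex consists of straight radii: the part of each
arm before its last visit to the disc is replaced by a radius. -/
theorem exists_straight [Finite V] [Finite H] (E : G.ArmEmbedding) :
    ∃ (E' : G.ArmEmbedding) (r : ℝ), 0 < r ∧
      (∀ h, ∀ t ≤ (1 / 2 : ℝ), E'.arm h t = E'.point (G.vert h) +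
        ((2 * t : ℝ) : ℂ) * (E'.arm h (1 / 2) - E'.point (G.vert h))) ∧
      (∀ h, dist (E'.arm h (1 / 2)) (E'.point (G.vert h)) = r) ∧
      ∀ h v, ∀ t ∈ Set.Icc (0 : ℝ) 1, (1 / 2 ≤ t ∨ v ≠ G.vert h) →
        r ≤ dist (E'.arm h t) (E'.point v) := by
  have ev1 : ∀ᶠ r : ℝ in 𝓝[>] 0, ∀ h : H, ∀ v : V, v ≠ G.vert h → ∀ t ∈ Set.Icc (0 : ℝ) 1,
      r < dist (E.arm h t) (E.point v) := by
    refine eventually_all.2 fun h => eventually_all.2 fun v => ?_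
    by_cases hv : v = G.vert h
    · exact Eventually.of_forall fun r hne => absurd hv hne
    · have hK : IsCompact (E.arm h '' Set.Icc (0 : ℝ) 1) :=
        isCompact_Icc.image (E.continuous_arm h)
      filter_upwards [hK.eventually_lt_dist (p := E.point v) (by
        rintro ⟨t, ht, e⟩
        rcases ht.1.eq_or_lt with rfl | ht0
        · rw [E.arm_zero] at e
          exact hv (E.point_injective e).symm
        · exact E.arm_ne_point h v t ⟨ht0, ht.2⟩ e)] with r hr _ t ht
      exact hr _ ⟨t, ht, rfl⟩
  have ev2 : ∀ᶠ r : ℝ in 𝓝[>] 0, ∀ h : H, r < dist (E.arm h 1) (E.point (G.vert h)) :=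
    eventually_all.2 fun h => by
      filter_upwards [Ioo_mem_nhdsGT (dist_pos.2
        (E.arm_ne_point h (G.vert h) 1 ⟨zero_lt_one, le_rfl⟩))] with r hr
      exact hr.2
  have ev3 : ∀ᶠ r : ℝ in 𝓝[>] 0, ∀ v w : V, v ≠ w → 2 * r < dist (E.point v) (E.point w) := by
    refine eventually_all.2 fun v => eventually_all.2 fun w => ?_
    by_cases hv : v = w
    · exact Eventually.of_forall fun r hne => absurd hv hne
    · filter_upwards [Ioo_mem_nhdsGT (half_pos (dist_pos.2 (E.point_injective.ne hv)))] with r hr _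
      linarith [hr.2]
  obtain ⟨r, hr1, hr2, hr3, hr0⟩ :=
    (ev1.and (ev2.and (ev3.and (eventually_mem_nhdsWithin)))).exists
  replace hr0 : 0 < r := hr0
  choose a ha hda hgt using fun h => exists_last_time_dist_eq (E.continuous_arm h) (E.arm_zero h)
    hr0 (hr2 h)
  -- up to time `1 / 2` the new arm is a radius, afterwards it is the rest of the old arm
  let q : H → ℂ := fun h => E.arm h (a h) - E.point (G.vert h)
  have hq : ∀ h, ‖q h‖ = r := fun h => by rw [← hda h, dist_eq_norm]
  let seg : H → ℝ → ℂ := fun h t => E.point (G.vert h) + ((2 * t : ℝ) : ℂ) * q h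
  let rest : H → ℝ → ℝ := fun h t => a h + (2 * t - 1) * (1 - a h)
  have hseg : ∀ h t, 0 ≤ t → dist (seg h t) (E.point (G.vert h)) = 2 * t * r := by
    intro h t ht
    rw [dist_eq_norm, add_sub_cancel_left, norm_mul, hq, Complex.norm_real, Real.norm_eq_abs,
      abs_of_nonneg (by linarith)]
  have hseg' : ∀ h t v, 0 ≤ t → t ≤ 1 / 2 → v ≠ G.vert h → r < dist (seg h t) (E.point v) := by
    intro h t v h0 h1 hv
    have e1 := hr3 _ _ hv
    have e2 := hseg h t h0
    have e3 := dist_triangle_left (E.point v) (E.point (G.vert h)) (seg h t)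
    nlinarith
  have hrest : ∀ h t, 1 / 2 < t → t ≤ 1 → rest h t ∈ Set.Ioc (a h) 1 := by
    intro h t h0 h1
    have := (ha h).2
    refine ⟨?_, ?_⟩ <;> simp only [rest] <;> nlinarith
  have hrest0 : ∀ h t, 1 / 2 < t → t ≤ 1 → rest h t ∈ Set.Ioc 0 1 := fun h t h0 h1 =>
    ⟨(ha h).1.trans (hrest h t h0 h1).1, (hrest h t h0 h1).2⟩
  have hrest' : ∀ h t v, 1 / 2 < t → t ≤ 1 → r < dist (E.arm h (rest h t)) (E.point v) := by
    intro h t v h0 h1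
    by_cases hv : v = G.vert h
    · exact hv ▸ hgt h _ (hrest h t h0 h1)
    · exact hr1 h v hv _ ⟨(hrest0 h t h0 h1).1.le, (hrest0 h t h0 h1).2⟩
  let arm' : H → ℝ → ℂ := fun h t => if t ≤ 1 / 2 then seg h t else E.arm h (rest h t)
  have arm'_le : ∀ h t, t ≤ 1 / 2 → arm' h t = seg h t := fun h t ht => if_pos ht
  have arm'_gt : ∀ h t, 1 / 2 < t → arm' h t = E.arm h (rest h t) := fun h t ht =>
    if_neg ht.not_ge
  have hmid : ∀ h, arm' h (1 / 2) = E.arm h (a h) := fun h => by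
    rw [arm'_le _ _ le_rfl]
    simp [seg, q]
  have rest_one : ∀ h, rest h 1 = 1 := fun h => by simp only [rest]; ring
  have mixed : ∀ h k s t, 0 ≤ s → s ≤ 1 / 2 → 1 / 2 < t → t ≤ 1 →
      seg h s ≠ E.arm k (rest k t) := by
    intro h k s t hs0 hs1 ht0 ht1 heq
    have e1 := hseg h s hs0
    have e2 := hrest' k t (G.vert h) ht0 ht1
    rw [heq] at e1
    nlinarith
  refine ⟨⟨E.point, arm', ?_, ?_, ?_, E.point_injective, ?_, ?_⟩, r, hr0, ?_, ?_, ?_⟩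
  · intro h
    have := E.continuous_arm h
    refine Continuous.if_le (by fun_prop) (by fun_prop) continuous_id continuous_const ?_
    rintro t rfl
    simp [seg, rest, q]
  · intro h
    rw [arm'_le _ _ (by norm_num)]
    simp [seg]
  · intro h
    rw [arm'_gt _ _ (by norm_num), arm'_gt _ _ (by norm_num), rest_one, rest_one, E.arm_opp_one]
  · intro h v t ht
    rcases le_or_gt t (1 / 2) with h1 | h1
    · rw [arm'_le _ _ h1, ← dist_pos]
      by_cases hv : v = G.vert h
      · rw [hv, hseg _ _ ht.1.le]
        have := ht.1
        positivity
      · exact hr0.trans (hseg' h t v ht.1.le h1 hv)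
    · rw [arm'_gt _ _ h1]
      exact E.arm_ne_point _ _ _ (hrest0 h t h1 ht.2)
  · intro h k s hs t ht heq
    rcases le_or_gt s (1 / 2) with h1 | h1 <;> rcases le_or_gt t (1 / 2) with h2 | h2
    · rw [arm'_le _ _ h1, arm'_le _ _ h2] at heq
      by_cases hv : G.vert h = G.vert k
      · have e1 := hseg h s hs.1.le
        have e2 := hseg k t ht.1.le
        rw [heq, hv] at e1
        have hst : t = s := by
          have := e1.symm.trans e2
          exact (mul_left_cancel₀ two_ne_zero (mul_right_cancel₀ hr0.ne' this)).symm
        subst hst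
        have ht0 : ((2 * t : ℝ) : ℂ) ≠ 0 := by
          have := ht.1
          exact_mod_cast (by positivity : (2 * t : ℝ) ≠ 0)
        simp only [seg, q, hv, add_right_inj] at heq
        have e3 : E.arm h (a h) = E.arm k (a k) := sub_left_inj.1 (mul_left_cancel₀ ht0 heq)
        obtain ⟨e4, e5 | ⟨-, e5⟩⟩ := E.arm_inj h k _ ⟨(ha h).1, (ha h).2.le⟩ _
          ⟨(ha k).1, (ha k).2.le⟩ e3
        · exact ⟨rfl, Or.inl e5⟩
        · exact absurd e5 (ha h).2.ne
      · exfalso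
        have e1 := hseg' h s (G.vert k) hs.1.le h1 (Ne.symm hv)
        have e2 := hseg k t ht.1.le
        rw [heq] at e1
        nlinarith
    · rw [arm'_le _ _ h1, arm'_gt _ _ h2] at heq
      exact absurd heq (mixed h k s t hs.1.le h1 h2 ht.2)
    · rw [arm'_gt _ _ h1, arm'_le _ _ h2] at heq
      exact absurd heq.symm (mixed k h t s ht.1.le h2 h1 hs.2)
    · rw [arm'_gt _ _ h1, arm'_gt _ _ h2] at heq
      obtain ⟨e1, e2⟩ := E.arm_inj h k _ (hrest0 h s h1 hs.2) _ (hrest0 k t h2 ht.2) heq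
      rcases e2 with rfl | ⟨e2, e3⟩
      · have := (ha k).2
        simp only [rest, add_right_inj] at e1
        have := mul_right_cancel₀ (by linarith) e1
        exact ⟨by linarith, Or.inl rfl⟩
      · have h3 : ∀ l u, rest l u = 1 → u = 1 := by
          intro l u hu
          have := (ha l).2
          have e5 : (2 * u - 1 - 1) * (1 - a l) = 0 := by
            simp only [rest] at hu
            linear_combination hu
          rcases mul_eq_zero.1 e5 with e6 | e6 <;> linarith
        have hs1 := h3 h s e3
        exact ⟨(h3 k t (e1.trans e3)).trans hs1.symm, Or.inr ⟨e2, hs1⟩⟩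
  · intro h t ht
    simp only [hmid]
    rw [arm'_le _ _ ht]
  · intro h
    simp only [hmid]
    exact hda h
  · intro h v t ht hor
    rcases le_or_gt t (1 / 2) with h1 | h1
    · by_cases hv : v = G.vert h
      · have h2 : t = 1 / 2 := le_antisymm h1 (hor.resolve_right (not_not.2 hv))
        simp only [h2, hmid, hv]
        exact (hda h).ge
      · simp only [arm'_le _ _ h1]
        exact (hseg' h t v ht.1 h1 hv).le
    · simp only [arm'_gt _ _ h1]
      exact (hrest' h t v h1 ht.2).le

end HalfEdgeGraph.ArmEmbedding

/-! ### Cycle graphs -/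

namespace SimpleGraph

theorem cycleGraph_adj_iff_val {n : ℕ} {i j : Fin n} : (cycleGraph n).Adj i j ↔ i ≠ j ∧
    ((i : ℕ) + 1 = j ∨ (j : ℕ) + 1 = i ∨ ((i : ℕ) = 0 ∧ (j : ℕ) + 1 = n) ∨
      ((j : ℕ) = 0 ∧ (i : ℕ) + 1 = n)) := by
  rw [cycleGraph_adj']
  have hi := i.2
  have hj := j.2
  rcases lt_trichotomy i j with h | rfl | h
  · have h1 := Fin.coe_sub_iff_lt.2 h
    have h2 := Fin.coe_sub_iff_le.2 h.le
    have h3 : (i : ℕ) < j := h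
    have h4 : i ≠ j := h.ne
    simp only [h1, h2, ne_eq, h4, not_false_eq_true, true_and]
    omega
  · simp [Fin.sub_def]
  · have h1 := Fin.coe_sub_iff_lt.2 h
    have h2 := Fin.coe_sub_iff_le.2 h.le
    have h3 : (j : ℕ) < i := h
    have h4 : i ≠ j := h.ne'
    simp only [h1, h2, ne_eq, h4, not_false_eq_true, true_and]
    omega

/-- Removing two adjacent vertices from a cycle leaves a connected graph. -/
theorem cycleGraph_rel_of_adj {n : ℕ} {i j : Fin n} (hij : (cycleGraph n).Adj i j)
    {R : Fin n → Fin n → Prop} (hsymm : ∀ {k l}, R k l → R l k)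
    (htrans : ∀ {k l m}, R k l → R l m → R k m) (hrefl : ∀ k, k ≠ i → k ≠ j → R k k)
    (hR : ∀ k l, (cycleGraph n).Adj k l → k ≠ i → k ≠ j → l ≠ i → l ≠ j → R k l) {k l : Fin n}
    (hki : k ≠ i) (hkj : k ≠ j) (hli : l ≠ i) (hlj : l ≠ j) : R k l := by
  have hi := i.2
  have hj := j.2
  have hne := (cycleGraph_adj_iff_val.1 hij).1
  -- by symmetry, `j` is the successor of `i`
  wlog h : (i : ℕ) + 1 = j ∨ ((j : ℕ) = 0 ∧ (i : ℕ) + 1 = n) generalizing i j with H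
  · refine H hij.symm (fun k h1 h2 => hrefl k h2 h1) (fun k l h h1 h2 h3 h4 => hR k l h h2 h1 h4 h3)
      hkj hki hlj hli hj hi hne.symm ?_
    have := (cycleGraph_adj_iff_val.1 hij).2
    omega
  -- the vertices after `j`, in cyclic order
  let f : ℕ → ℕ := fun m => if j + 1 + m < n then j + 1 + m else j + 1 + m - n
  have hf : ∀ m, m + 3 ≤ n → f m < n ∧ f m ≠ i ∧ f m ≠ j := by
    intro m hm
    simp only [f]
    split_ifs <;> omega
  have key : ∀ m, ∀ hm : m + 3 ≤ n, R ⟨f 0, (hf 0 (by omega)).1⟩ ⟨f m, (hf m hm).1⟩ := by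
    intro m
    induction m with
    | zero =>
      intro hm
      exact hrefl _ (fun e => (hf 0 hm).2.1 (congrArg Fin.val e))
        (fun e => (hf 0 hm).2.2 (congrArg Fin.val e))
    | succ m ih =>
      intro hm
      refine htrans (ih (by omega)) (hR _ _ ?_
        (fun e => (hf m (by omega)).2.1 (congrArg Fin.val e))
        (fun e => (hf m (by omega)).2.2 (congrArg Fin.val e))
        (fun e => (hf _ hm).2.1 (congrArg Fin.val e))
        (fun e => (hf _ hm).2.2 (congrArg Fin.val e)))
      rw [cycleGraph_adj_iff_val]
      simp only [f, ne_eq, Fin.mk.injEq]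
      split_ifs <;> omega
  have surj : ∀ k : Fin n, k ≠ i → k ≠ j → R ⟨f 0, (hf 0 (by omega)).1⟩ k := by
    intro k h1 h2
    have hk := k.2
    have h1' : (k : ℕ) ≠ i := fun e => h1 (Fin.ext e)
    have h2' : (k : ℕ) ≠ j := fun e => h2 (Fin.ext e)
    obtain ⟨m, hm, hkm⟩ : ∃ m, ∃ hm : m + 3 ≤ n, k = ⟨f m, (hf m hm).1⟩ := by
      rcases lt_or_gt_of_ne h2' with h3 | h3
      · refine ⟨k + n - j - 1, by omega, Fin.ext ?_⟩
        simp only [f]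
        split_ifs <;> omega
      · refine ⟨k - j - 1, by omega, Fin.ext ?_⟩
        simp only [f]
        split_ifs <;> omega
    rw [hkm]
    exact key m hm
  exact htrans (hsymm (surj k hki hkj)) (surj l hli hlj)

/-- Two vertices of a cycle that are not adjacent have vertices strictly between them on both
sides. -/
theorem exists_interlaced_of_not_cycleGraph_adj {n : ℕ} {i j : Fin n} (hij : i < j)
    (h : ¬ (cycleGraph n).Adj i j) : ∃ k l : Fin n, i < k ∧ k < j ∧ (l < i ∨ j < l) := by
  rw [cycleGraph_adj_iff_val] at h
  have hne := hij.ne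
  have hj := j.2
  have hij' : (i : ℕ) < j := hij
  refine ⟨⟨i + 1, by omega⟩, if 0 < (i : ℕ) then ⟨0, by omega⟩ else ⟨n - 1, by omega⟩, ?_, ?_, ?_⟩
  · rw [Fin.lt_def]; simp
  · rw [Fin.lt_def]; simp only; omega
  · split_ifs with h0
    · left; rw [Fin.lt_def]; exact h0
    · right; rw [Fin.lt_def]; simp only; omega

/-- A graph isomorphic to a finite graph that contains it is equal to it. -/
theorem eq_of_le_of_iso {α : Type*} [Finite α] {F K : SimpleGraph α} (h : F ≤ K)
    (e : F ≃g K) : F = K := by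
  classical
  have := Fintype.ofFinite α
  rw [← edgeFinset_inj]
  exact Finset.eq_of_subset_of_card_le (edgeFinset_mono h) e.card_edgeFinset_eq.ge

end SimpleGraph

/-! ### The order of the spokes of a wheel -/

theorem joinedIn_of_curve {γ : ℝ → ℂ} (hγ : Continuous γ) {X : Set ℂ} {a b : ℝ} (hab : a ≤ b)
    (h : ∀ t ∈ Set.Icc a b, γ t ∈ X) : JoinedIn X (γ a) (γ b) := by
  have hp : IsPathConnected (γ '' Set.Icc a b) :=
    ((convex_Icc a b).isPathConnected ⟨a, Set.left_mem_Icc.2 hab⟩).image hγ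
  exact (hp.joinedIn _ ⟨a, Set.left_mem_Icc.2 hab, rfl⟩ _ ⟨b, Set.right_mem_Icc.2 hab, rfl⟩).mono
    (by rintro _ ⟨t, ht, rfl⟩; exact h t ht)

theorem exists_eq_add_mul_exp {z p : ℂ} {r : ℝ} (h : dist z p = r) :
    ∃ θ ∈ Set.Ico 0 (2 * Real.pi), z = p + r * Complex.exp ((θ : ℂ) * Complex.I) := by
  have e : z = p + r * Complex.exp ((z - p).arg * Complex.I) := by
    rw [← h, dist_eq_norm, Complex.norm_mul_exp_arg_mul_I]
    ring
  have h1 := Complex.neg_pi_lt_arg (z - p)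
  have h2 := Complex.arg_le_pi (z - p)
  have := Real.pi_pos
  by_cases h0 : 0 ≤ (z - p).arg
  · exact ⟨_, ⟨h0, by linarith⟩, e⟩
  · refine ⟨(z - p).arg + 2 * Real.pi, ⟨by linarith, by linarith⟩, ?_⟩
    rw [exp_ofReal_add_two_pi_mul_I]
    exact e

theorem exists_equiv_fin_strictMono {α : Type*} {n : ℕ} (e : α ≃ Fin n) {f : α → ℝ}
    (hf : Function.Injective f) : ∃ σ : Fin n ≃ α, StrictMono (f ∘ σ) := by
  let _ : LinearOrder α := LinearOrder.lift' f hf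
  let _ : Fintype α := Fintype.ofEquiv _ e.symm
  let o := Fintype.orderIsoFinOfCardEq α (k := n) (by rw [Fintype.card_congr e, Fintype.card_fin])
  refine ⟨o.toEquiv, fun i j hij => ?_⟩
  have : o i < o j := o.strictMono hij
  exact this

namespace StarGraph

open HalfEdgeGraph

variable {V H : Type*} {G : StarGraph V H}

/-- The edges of the web graph among the centre and the new vertices on the half-edges in `S`: the
spokes of the half-edges in `S`, and the rim edges joining two such half-edges. -/
def wheelPart (G : StarGraph V H) (S : Set H) : Set G.WebHalfEdge
  | .out h => h ∈ S
  | .into h => h ∈ S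
  | .mid _ => False
  | .rim _ d => d.fst.1 ∈ S ∧ d.snd.1 ∈ S

/-- The part of a drawing of the web graph formed by `wheelPart S` and the new vertices on the
half-edges in `S`, outside a disc. -/
def wheelRegion (E : G.web.ArmEmbedding) (S : Set H) (p : ℂ) (r : ℝ) : Set ℂ :=
  E.body (G.wheelPart S) (Sum.inr '' S) ∩ {z | r ≤ dist z p}

theorem disjoint_wheelRegion (E : G.web.ArmEmbedding) {S T : Set H} (hST : Disjoint S T) (p : ℂ)
    (r : ℝ) : Disjoint (wheelRegion E S p r) (wheelRegion E T p r) := by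
  refine (E.disjoint_body ?_ ?_ ?_).mono Set.inter_subset_left Set.inter_subset_left
  · rintro (h | h | h | ⟨v, d⟩) hx
    · exact hx
    · exact hx
    · exact hx.elim
    · exact ⟨hx.2, hx.1⟩
  · rw [Set.disjoint_left] at hST ⊢
    rintro (h | h | h | ⟨v, d⟩) hx hy
    · exact hST hx hy
    · exact hST hx hy
    · exact hx.elim
    · exact hST hx.1 hy.1
  · exact (Set.disjoint_image_iff Sum.inr_injective).2 hST

section Straight

variable {E : G.web.ArmEmbedding} {r : ℝ}
  (hfar : ∀ h v, ∀ t ∈ Set.Icc (0 : ℝ) 1, (1 / 2 ≤ t ∨ v ≠ G.web.vert h) →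
    r ≤ dist (E.arm h t) (E.point v))

include hfar

theorem arm_mem_wheelRegion {S : Set H} {v : V} {x : G.WebHalfEdge} (hx : x ∈ G.wheelPart S)
    {h : H} (hxh : G.web.vert x = .inr h) (hh : h ∈ S) {t : ℝ} (ht : t ∈ Set.Icc (0 : ℝ) 1) :
    E.arm x t ∈ wheelRegion E S (E.point (.inl v)) r := by
  refine ⟨?_, hfar x _ t ht (Or.inr (by rw [hxh]; exact Sum.inl_ne_inr))⟩
  rcases ht.1.eq_or_lt with rfl | h0
  · rw [E.arm_zero, hxh]
    exact Or.inl ⟨_, ⟨h, hh, rfl⟩, rfl⟩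
  · exact Or.inr ⟨x, hx, t, ⟨h0, ht.2⟩, rfl⟩

theorem joinedIn_spoke {S : Set H} {v : V} {h : H} (hh : h ∈ S) :
    JoinedIn (wheelRegion E S (E.point (.inl v)) r) (E.arm (.out h) (1 / 2))
      (E.point (.inr h)) := by
  have h1 : JoinedIn (wheelRegion E S (E.point (.inl v)) r) (E.arm (.out h) (1 / 2))
      (E.arm (.out h) 1) := by
    refine joinedIn_of_curve (E.continuous_arm _) (by norm_num) fun t ht => ⟨?_, ?_⟩
    · exact Or.inr ⟨_, hh, t, ⟨by linarith [ht.1], ht.2⟩, rfl⟩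
    · exact hfar _ _ t ⟨by linarith [ht.1], ht.2⟩ (Or.inl ht.1)
  have h2 : JoinedIn (wheelRegion E S (E.point (.inl v)) r) (E.arm (.into h) 0)
      (E.arm (.into h) 1) := by
    refine joinedIn_of_curve (E.continuous_arm _) zero_le_one fun t ht => ?_
    exact arm_mem_wheelRegion hfar (x := .into h) hh rfl hh ht
  have e : E.arm (.into h) 1 = E.arm (.out h) 1 := E.arm_opp_one (.out h)
  rw [e, E.arm_zero] at h2
  exact h1.trans h2.symm

theorem joinedIn_wheelRegion_of_adj {S : Set H} {v : V} {a b : {h : H // G.vert h = v}}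
    (hab : (G.adj v).Adj a b) (ha : a.1 ∈ S) (hb : b.1 ∈ S) :
    JoinedIn (wheelRegion E S (E.point (.inl v)) r) (E.arm (.out a.1) (1 / 2))
      (E.arm (.out b.1) (1 / 2)) := by
  have h1 : ∀ d : (G.adj v).Dart, d.fst.1 ∈ S → d.snd.1 ∈ S →
      JoinedIn (wheelRegion E S (E.point (.inl v)) r) (E.point (.inr d.fst.1))
        (E.arm (.rim v d) 1) := by
    intro d hd1 hd2
    have := joinedIn_of_curve (E.continuous_arm (.rim v d)) zero_le_one fun t ht =>
      arm_mem_wheelRegion hfar (v := v) (x := .rim v d) ⟨hd1, hd2⟩ rfl hd1 ht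
    rwa [E.arm_zero] at this
  let d : (G.adj v).Dart := ⟨(a, b), hab⟩
  have h2 := h1 d ha hb
  have h3 := h1 d.symm hb ha
  have e : E.arm (.rim v d.symm) 1 = E.arm (.rim v d) 1 := E.arm_opp_one (.rim v d)
  rw [e] at h3
  exact ((joinedIn_spoke hfar ha).trans h2).trans (h3.symm.trans (joinedIn_spoke hfar hb).symm)

/-- Two spokes are connected outside the disc around the centre without using two other spokes that
are adjacent on the rim, nor the rim edges at these: the rest of the rim connects them. -/
theorem joinedIn_wheelRegion_compl {v : V} {a b : {h : H // G.vert h = v}}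
    (hab : (G.adj v).Adj a b) {k l : {h : H // G.vert h = v}} (hka : k ≠ a) (hkb : k ≠ b)
    (hla : l ≠ a) (hlb : l ≠ b) :
    JoinedIn (wheelRegion E {a.1, b.1}ᶜ (E.point (.inl v)) r) (E.arm (.out k.1) (1 / 2))
      (E.arm (.out l.1) (1 / 2)) := by
  have hmem : ∀ c : {h : H // G.vert h = v}, c ≠ a → c ≠ b → c.1 ∈ ({a.1, b.1} : Set H)ᶜ := by
    intro c h1 h2 h3
    rcases h3 with h3 | h3
    · exact h1 (Subtype.ext h3)
    · exact h2 (Subtype.ext h3)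
  obtain ⟨n, ⟨ψ⟩⟩ := G.adj_cycle v
  have hne : ∀ {c x}, c ≠ ψ x → ψ.symm c ≠ x := by
    rintro c x h rfl
    exact h (ψ.apply_symm_apply c).symm
  have := SimpleGraph.cycleGraph_rel_of_adj (ψ.map_adj_iff.2 hab)
    (R := fun c c' => JoinedIn (wheelRegion E {a.1, b.1}ᶜ (E.point (.inl v)) r)
      (E.arm (.out (ψ.symm c).1) (1 / 2)) (E.arm (.out (ψ.symm c').1) (1 / 2)))
    (fun h => h.symm) (fun h h' => h.trans h')
    (fun c h1 h2 => JoinedIn.refl (joinedIn_spoke hfar (hmem _ (hne h1) (hne h2))).source_mem)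
    (fun c c' hcc h1 h2 h3 h4 => joinedIn_wheelRegion_of_adj hfar (ψ.symm.map_adj_iff.2 hcc)
      (hmem _ (hne h1) (hne h2)) (hmem _ (hne h3) (hne h4)))
    (ψ.injective.ne hka) (ψ.injective.ne hkb) (ψ.injective.ne hla) (ψ.injective.ne hlb)
  simpa only [RelIso.symm_apply_apply] using this

/-- In a drawing of a web graph with straight spokes around the centre `v`, the order of the spokes
by angle is compatible with the given cyclic order: if two spokes `a`, `b` that are adjacent on the
rim were separated, at `v`, by spokes `k` and `l`, then the connection of `a` and `b` through their
rim edge would be disjoint from a connection of `k` and `l` through the rest of the rim. -/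
theorem cycleGraph_adj_of_adj (hr : 0 < r) {v : V} {θ : {h : H // G.vert h = v} → ℝ}
    (hθ : ∀ h, θ h ∈ Set.Ico 0 (2 * Real.pi))
    (hθE : ∀ h, E.arm (.out h.1) (1 / 2) =
      E.point (.inl v) + r * Complex.exp ((θ h : ℂ) * Complex.I))
    {n : ℕ} {σ : Fin n ≃ {h : H // G.vert h = v}} (hσ : StrictMono (θ ∘ σ)) {i j : Fin n}
    (hij : (G.adj v).Adj (σ i) (σ j)) : (SimpleGraph.cycleGraph n).Adj i j := by
  wlog hlt : i < j generalizing i j with H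
  · have hne : i ≠ j := by
      rintro rfl
      exact (G.adj v).loopless.irrefl _ hij
    exact (H hij.symm (lt_of_le_of_ne (not_lt.1 hlt) hne.symm)).symm
  by_contra hnot
  obtain ⟨k, l, hik, hkj, hl⟩ := SimpleGraph.exists_interlaced_of_not_cycleGraph_adj hlt hnot
  have hli : l ≠ i := by
    rintro rfl
    rcases hl with h | h
    · exact lt_irrefl _ h
    · exact lt_asymm h hlt
  have hlj : l ≠ j := by
    rintro rfl
    rcases hl with h | h
    · exact lt_asymm h hlt
    · exact lt_irrefl _ h
  have hA := joinedIn_wheelRegion_of_adj hfar (S := {(σ i).1, (σ j).1}) hij (Or.inl rfl)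
    (Or.inr rfl)
  have hB := joinedIn_wheelRegion_compl hfar hij (σ.injective.ne hik.ne') (σ.injective.ne hkj.ne)
    (σ.injective.ne hli) (σ.injective.ne hlj)
  rw [hθE, hθE] at hA hB
  have hdisj := disjoint_wheelRegion E (S := {(σ i).1, (σ j).1}) (T := {(σ i).1, (σ j).1}ᶜ)
    disjoint_compl_right (E.point (.inl v)) r
  have hd : ∀ S, ∀ z ∈ wheelRegion E S (E.point (.inl v)) r, r ≤ dist z (E.point (.inl v)) :=
    fun S z hz => hz.2
  have h1 : θ (σ i) < θ (σ k) := hσ hik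
  have h2 : θ (σ k) < θ (σ j) := hσ hkj
  rcases hl with hl | hl
  · have h3 : θ (σ l) < θ (σ i) := hσ hl
    rw [← exp_ofReal_add_two_pi_mul_I (θ (σ l))] at hB
    exact not_disjoint_of_joinedIn_of_interlaced hr (hd _) (hd _) h1 h2
      (by linarith [(hθ (σ j)).2, (hθ (σ l)).1]) (by linarith) hA hB hdisj
  · have h3 : θ (σ j) < θ (σ l) := hσ hl
    exact not_disjoint_of_joinedIn_of_interlaced hr (hd _) (hd _) h1 h2 h3
      (by linarith [(hθ (σ l)).2, (hθ (σ i)).1]) hA hB hdisj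

end Straight

end StarGraph

/-! ### From a drawing of the web graph to a drawing of the graph -/

namespace StarGraph

open HalfEdgeGraph

variable {V H : Type*} {G : StarGraph V H}

/-- The arm of `h` in the drawing of `G` contained in a drawing of its web graph: the spoke of `h`,
in two halves, followed by half of the middle part of its edge. -/
noncomputable def mergedArm (E : G.web.ArmEmbedding) (h : H) (t : ℝ) : ℂ :=
  if t ≤ 1 / 3 then E.arm (.out h) (3 * t)
  else if t ≤ 2 / 3 then E.arm (.into h) (2 - 3 * t) else E.arm (.mid h) (3 * t - 2)

/-- Away from the new vertex, `mergedArm` runs in the interior of an edge of the web graph. -/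
theorem mergedArm_cases (E : G.web.ArmEmbedding) (h : H) (t : ℝ) :
    (t ≤ 1 / 3 ∧ mergedArm E h t = E.arm (.out h) (3 * t)) ∨
    (1 / 3 < t ∧ t < 2 / 3 ∧ mergedArm E h t = E.arm (.into h) (2 - 3 * t)) ∨
    (t = 2 / 3 ∧ mergedArm E h t = E.point (.inr h)) ∨
    (2 / 3 < t ∧ mergedArm E h t = E.arm (.mid h) (3 * t - 2)) := by
  unfold mergedArm
  rcases le_or_gt t (1 / 3) with h1 | h1
  · exact Or.inl ⟨h1, if_pos h1⟩
  · rw [if_neg h1.not_ge]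
    rcases lt_trichotomy t (2 / 3) with h2 | h2 | h2
    · exact Or.inr (Or.inl ⟨h1, h2, if_pos h2.le⟩)
    · refine Or.inr (Or.inr (Or.inl ⟨h2, ?_⟩))
      rw [if_pos h2.le, show (2 : ℝ) - 3 * t = 0 by rw [h2]; norm_num, E.arm_zero]
      rfl
    · exact Or.inr (Or.inr (Or.inr ⟨h2, if_neg h2.not_ge⟩))

theorem continuous_mergedArm (E : G.web.ArmEmbedding) (h : H) : Continuous (mergedArm E h) := by
  have h1 := E.continuous_arm (.out h)
  have h2 := E.continuous_arm (.into h)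
  have h3 := E.continuous_arm (.mid h)
  refine Continuous.if_le (by fun_prop) (Continuous.if_le (by fun_prop) (by fun_prop)
    continuous_id continuous_const ?_) continuous_id continuous_const ?_
  · rintro t rfl
    norm_num [E.arm_zero]
    rfl
  · rintro t rfl
    norm_num
    exact (E.arm_opp_one (.out h)).symm

theorem mergedArm_ne_point (E : G.web.ArmEmbedding) (h : H) (v : V) {t : ℝ}
    (ht : t ∈ Set.Ioc (0 : ℝ) 1) : mergedArm E h t ≠ E.point (.inl v) := by
  obtain ⟨h0, h1⟩ := ht
  rcases mergedArm_cases E h t with ⟨h2, e⟩ | ⟨h2, h3, e⟩ | ⟨h2, e⟩ | ⟨h2, e⟩ <;> rw [e]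
  · exact E.arm_ne_point _ _ _ ⟨by linarith, by linarith⟩
  · exact E.arm_ne_point _ _ _ ⟨by linarith, by linarith⟩
  · exact E.point_injective.ne Sum.inr_ne_inl
  · exact E.arm_ne_point _ _ _ ⟨by linarith, by linarith⟩

theorem mergedArm_inj (E : G.web.ArmEmbedding) (h k : H) {s t : ℝ} (hs : s ∈ Set.Ioc (0 : ℝ) 1)
    (ht : t ∈ Set.Ioc (0 : ℝ) 1) (heq : mergedArm E h s = mergedArm E k t) :
    t = s ∧ (k = h ∨ (k = G.opp h ∧ s = 1)) := by
  have key : ∀ x y : G.WebHalfEdge, ∀ a b : ℝ, 0 < a → a ≤ 1 → 0 < b → b ≤ 1 →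
      E.arm x a = E.arm y b → b = a ∧ (y = x ∨ (y = G.webOpp x ∧ a = 1)) :=
    fun x y a b h1 h2 h3 h4 e => E.arm_inj x y a ⟨h1, h2⟩ b ⟨h3, h4⟩ e
  have keyp : ∀ x : G.WebHalfEdge, ∀ w, ∀ a : ℝ, 0 < a → a ≤ 1 → E.arm x a ≠ E.point w :=
    fun x w a h1 h2 => E.arm_ne_point x w a ⟨h1, h2⟩
  have hs0 := hs.1
  have hs1 := hs.2
  have ht0 := ht.1
  have ht1 := ht.2
  rcases mergedArm_cases E h s with ⟨h2, e⟩ | ⟨h2, h3, e⟩ | ⟨h2, e⟩ | ⟨h2, e⟩ <;>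
  rcases mergedArm_cases E k t with ⟨h2', e'⟩ | ⟨h2', h3', e'⟩ | ⟨h2', e'⟩ | ⟨h2', e'⟩ <;>
  rw [e, e'] at heq
  case inr.inr.inl.inr.inr.inl =>
    exact ⟨h2'.trans h2.symm, Or.inl (Sum.inr_injective (E.point_injective heq)).symm⟩
  case inr.inr.inl.inl | inr.inr.inl.inr.inl | inr.inr.inl.inr.inr.inr =>
    exact absurd heq.symm (keyp _ _ _ (by linarith) (by linarith))
  case inl.inr.inr.inl | inr.inl.inr.inr.inl | inr.inr.inr.inr.inr.inl =>
    exact absurd heq (keyp _ _ _ (by linarith) (by linarith))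
  all_goals
    obtain ⟨e1, e2⟩ := key _ _ _ _ (by linarith) (by linarith) (by linarith) (by linarith) heq
    simp only [webOpp, WebHalfEdge.out.injEq, WebHalfEdge.into.injEq, WebHalfEdge.mid.injEq,
      reduceCtorEq, false_and, or_false, false_or] at e2
  · exact ⟨by linarith, Or.inl e2⟩
  · exact absurd e2.2 (by linarith)
  · exact absurd e2.2 (by linarith)
  · exact ⟨by linarith, Or.inl e2⟩
  · exact ⟨by linarith, e2.imp_right fun h => ⟨h.1, by linarith [h.2]⟩⟩

/-- A drawing of the web graph contains a drawing of the graph. -/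
noncomputable def merge (E : G.web.ArmEmbedding) : G.toHalfEdgeGraph.ArmEmbedding where
  point v := E.point (.inl v)
  arm := mergedArm E
  continuous_arm := continuous_mergedArm E
  arm_zero h := by
    rw [mergedArm, if_pos (by norm_num), mul_zero, E.arm_zero]
    rfl
  arm_opp_one h := by
    have h1 : ∀ k, mergedArm E k 1 = E.arm (.mid k) 1 := by
      intro k
      rw [mergedArm, if_neg (by norm_num), if_neg (by norm_num)]
      norm_num
    rw [h1, h1]
    exact E.arm_opp_one (.mid h)
  point_injective := E.point_injective.comp Sum.inl_injective
  arm_ne_point h v _ ht := mergedArm_ne_point E h v ht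
  arm_inj h k _ hs _ ht heq := mergedArm_inj E h k hs ht heq

theorem merge_arm_of_le (E : G.web.ArmEmbedding) (h : H) {t : ℝ} (ht : t ≤ 1 / 3) :
    (merge E).arm h t = E.arm (.out h) (3 * t) := if_pos ht

instance [Finite V] [Finite H] : Finite G.WebHalfEdge := by
  have : ∀ v, Finite (G.adj v).Dart := fun v => Finite.of_injective
    SimpleGraph.Dart.toProd (SimpleGraph.Dart.toProd_injective)
  let f : G.WebHalfEdge → (H ⊕ H) ⊕ (H ⊕ (Σ v, (G.adj v).Dart))
    | .out h => .inl (.inl h)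
    | .into h => .inl (.inr h)
    | .mid h => .inr (.inl h)
    | .rim v d => .inr (.inr ⟨v, d⟩)
  refine Finite.of_injective f ?_
  rintro (h | h | h | ⟨v, d⟩) (k | k | k | ⟨w, e⟩) heq <;> simp_all [f]

open Filter Topology in
theorem isPlanar_of_web_isPlanar [Finite V] [Finite H] (hG : G.web.IsPlanar) : G.IsPlanar := by
  obtain ⟨D⟩ := hG
  obtain ⟨E, r, hr, hstraight, hdist, hfar⟩ := D.toArmEmbedding.exists_straight
  refine ⟨(merge E).toPlaneEmbedding, fun v => ?_⟩
  have hθ : ∀ h : {h : H // G.vert h = v}, ∃ θ ∈ Set.Ico 0 (2 * Real.pi),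
      E.arm (.out h.1) (1 / 2) = E.point (.inl v) + r * Complex.exp ((θ : ℂ) * Complex.I) := by
    rintro ⟨h, rfl⟩
    exact exists_eq_add_mul_exp (hdist (.out h))
  choose θ hθ hθE using hθ
  obtain ⟨n, ⟨ψ⟩⟩ := G.adj_cycle v
  have hθinj : Function.Injective θ := by
    intro h k e
    have e1 := hθE h
    rw [e, ← hθE k] at e1
    obtain ⟨-, e2 | ⟨e2, -⟩⟩ := E.arm_inj _ _ _ ⟨by norm_num, by norm_num⟩ _
      ⟨by norm_num, by norm_num⟩ e1
    · exact Subtype.ext (WebHalfEdge.out.inj e2).symm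
    · exact absurd e2 (by simp [web, webOpp])
  obtain ⟨σ, hσ⟩ := exists_equiv_fin_strictMono ψ.toEquiv hθinj
  -- the given cyclic order is contained in the order by angle, and has as many adjacencies
  have hle : (G.adj v).comap σ ≤ SimpleGraph.cycleGraph n := fun i j hij =>
    cycleGraph_adj_of_adj hfar hr hθ hθE hσ hij
  have heq : (G.adj v).comap σ = SimpleGraph.cycleGraph n :=
    SimpleGraph.eq_of_le_of_iso hle ((SimpleGraph.Iso.comap σ (G.adj v)).trans ψ)
  let φ : G.adj v ≃g SimpleGraph.cycleGraph n :=
    ⟨σ.symm, by intro a b; rw [← heq]; simp⟩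
  refine ⟨n, φ, (Homeomorph.addRight (-E.point (.inl v))).toOpenPartialHomeomorph, θ ∘ σ,
    Set.mem_univ _, ?_, hσ, fun i => hθ _, ?_⟩
  · exact add_neg_cancel _
  · intro h
    have hsmall : ∀ᶠ t : unitInterval in 𝓝[>] 0, (t : ℝ) < 1 / 12 := by
      refine nhdsWithin_le_nhds ?_
      exact (isOpen_lt continuous_subtype_val continuous_const).mem_nhds (by simp)
    filter_upwards [hsmall, self_mem_nhdsWithin] with t ht ht0
    have ht0' : (0 : ℝ) < t := ht0
    refine ⟨Set.mem_univ _, 12 * t * r, by positivity, ?_⟩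
    have e1 : (merge E).toPlaneEmbedding.arc h.1 t = E.arm (.out h.1) (3 * (2 * t)) := by
      rw [← merge_arm_of_le E h.1 (by linarith)]
      exact (merge E).arc_of_le h.1 (by linarith)
    have e2 : G.web.vert (.out h.1) = .inl v := congrArg Sum.inl h.2
    have e3 : θ ((σ ∘ φ.toEquiv) h) = θ h := congrArg θ (σ.apply_symm_apply h)
    simp only [Homeomorph.toOpenPartialHomeomorph_apply, Homeomorph.coe_addRight, e1]
    rw [hstraight _ _ (by linarith), e2, hθE]
    simp only [Function.comp_apply] at e3 ⊢
    rw [e3]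
    push_cast
    ring

end StarGraph

/-! ### Arcs between marked points of a circle -/

theorem eq_of_exp_mul_I_eq {x y a : ℝ} (hx : x ∈ Set.Ico a (a + 2 * Real.pi))
    (hy : y ∈ Set.Ico a (a + 2 * Real.pi))
    (h : Complex.exp (x * Complex.I) = Complex.exp (y * Complex.I)) : x = y := by
  obtain ⟨n, hn⟩ := Complex.exp_eq_exp_iff_exists_int.1 h
  have h1 : x = y + n * (2 * Real.pi) := by
    have h2 := congrArg Complex.im hn
    simpa using h2
  have hpi := Real.pi_pos
  have h3 : n = 0 := by
    have h4 : ((n : ℝ)) * (2 * Real.pi) < 1 * (2 * Real.pi) := by linarith [hx.2, hy.1]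
    have h5 : (-1 : ℝ) * (2 * Real.pi) < n * (2 * Real.pi) := by linarith [hx.1, hy.2]
    have h6 : (n : ℝ) < 1 := lt_of_mul_lt_mul_right h4 (by positivity)
    have h7 : (-1 : ℝ) < n := lt_of_mul_lt_mul_right h5 (by positivity)
    have h8 : n < 1 := by exact_mod_cast h6
    have h9 : -1 < n := by exact_mod_cast h7
    omega
  simpa [h3] using h1

/-- Angles along a circle with `n` marked points `θ 0 < ⋯ < θ (n - 1)`. For cyclically adjacent `i`
and `j`, the angle `A i j t` runs, for `0 ≤ t ≤ 1`, from `θ i` to the middle of an arc between the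
two marked points, in such a way that `A i j` and `A j i` use the same arc (this matters only for
`n = 2`) and different pairs use different arcs. -/
theorem exists_rimAngles {n : ℕ} {θ : Fin n → ℝ} (hmono : StrictMono θ)
    (hθ : ∀ i, θ i ∈ Set.Ico 0 (2 * Real.pi)) :
    ∃ A : Fin n → Fin n → ℝ → ℝ, (∀ i j, Continuous (A i j)) ∧
      ∀ i j, (SimpleGraph.cycleGraph n).Adj i j →
        Complex.exp (A i j 0 * Complex.I) = Complex.exp (θ i * Complex.I) ∧
        A i j 1 = A j i 1 ∧
        (∀ t ∈ Set.Ioc (0 : ℝ) 1, ∀ k,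
          Complex.exp (A i j t * Complex.I) ≠ Complex.exp (θ k * Complex.I)) ∧
        ∀ i' j', (SimpleGraph.cycleGraph n).Adj i' j' → ∀ s ∈ Set.Ioc (0 : ℝ) 1,
          ∀ t ∈ Set.Ioc (0 : ℝ) 1,
          Complex.exp (A i j s * Complex.I) = Complex.exp (A i' j' t * Complex.I) →
          t = s ∧ ((i' = i ∧ j' = j) ∨ ((i' = j ∧ j' = i) ∧ s = 1)) := by
  rcases Nat.eq_zero_or_pos n with rfl | hn
  · exact ⟨fun _ _ _ => 0, fun _ _ => continuous_const, fun i => i.elim0⟩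
  -- the marked points, followed by the first one after a full turn
  let T : ℕ → ℝ := fun m => if h : m < n then θ ⟨m, h⟩ else θ ⟨0, hn⟩ + 2 * Real.pi
  have hT : ∀ i : Fin n, T i = θ i := fun i => dif_pos i.2
  have hT0 : T 0 = θ ⟨0, hn⟩ := dif_pos hn
  have hTn : T n = T 0 + 2 * Real.pi := by rw [hT0]; exact dif_neg (lt_irrefl n)
  have hTmono : ∀ a b, a < b → b ≤ n → T a < T b := by
    intro a b hab hb
    have ha : a < n := hab.trans_le hb
    rcases hb.lt_or_eq with hb | rfl
    · rw [hT ⟨a, ha⟩, hT ⟨b, hb⟩]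
      exact hmono hab
    · rw [hT ⟨a, ha⟩, hTn, hT0]
      linarith [(hθ ⟨a, ha⟩).2, (hθ ⟨0, hn⟩).1]
  have hTle : ∀ a b, a ≤ b → b ≤ n → T a ≤ T b := by
    intro a b hab hb
    rcases hab.eq_or_lt with rfl | h
    · exact le_rfl
    · exact (hTmono a b h hb).le
  -- the arc used by a pair, and whether it is traversed upwards
  let code : ℕ → ℕ → ℕ × Bool := fun i j =>
    if j = i + 1 then (i, true) else if i = j + 1 then (j, false)
    else if j < i then (i, true) else (j, false)
  have hcode : ∀ i j : Fin n, (SimpleGraph.cycleGraph n).Adj i j → ∃ m < n,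
      (code i j = (m, true) ∧ code j i = (m, false) ∧ (i : ℕ) = m ∧
        ((j : ℕ) = m + 1 ∨ ((j : ℕ) = 0 ∧ m + 1 = n))) ∨
      (code i j = (m, false) ∧ code j i = (m, true) ∧ (j : ℕ) = m ∧
        ((i : ℕ) = m + 1 ∨ ((i : ℕ) = 0 ∧ m + 1 = n))) := by
    intro i j hij
    have hi := i.2
    have hj := j.2
    obtain ⟨h0, h⟩ := SimpleGraph.cycleGraph_adj_iff_val.1 hij
    have h0' : (i : ℕ) ≠ j := fun e => h0 (Fin.ext e)
    simp only [code]
    split_ifs with h1 h2 h3 h4 h5 h6 <;> first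
      | omega
      | exact ⟨i, hi, Or.inl ⟨rfl, rfl, rfl, by omega⟩⟩
      | exact ⟨j, hj, Or.inr ⟨rfl, rfl, rfl, by omega⟩⟩
  let ang : ℕ × Bool → ℝ → ℝ := fun c t =>
    if c.2 then T c.1 + t * ((T (c.1 + 1) - T c.1) / 2)
    else T (c.1 + 1) - t * ((T (c.1 + 1) - T c.1) / 2)
  have hangI : ∀ m b t, m < n → t ∈ Set.Ioc (0 : ℝ) 1 →
      ang (m, b) t ∈ Set.Ioo (T m) (T (m + 1)) := by
    intro m b t hm ht
    have h1 := hTmono m (m + 1) (Nat.lt_succ_self m) hm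
    have h2 := ht.1
    have h3 := ht.2
    cases b <;> simp only [ang, if_true, Bool.false_eq_true, if_false] <;>
      constructor <;> nlinarith
  have hangJ : ∀ m b t, m < n → t ∈ Set.Ioc (0 : ℝ) 1 →
      ang (m, b) t ∈ Set.Ico (T 0) (T 0 + 2 * Real.pi) := by
    intro m b t hm ht
    have h1 := hangI m b t hm ht
    rw [← hTn]
    exact ⟨(hTle 0 m (Nat.zero_le m) hm.le).trans h1.1.le,
      h1.2.trans_le (hTle (m + 1) n hm le_rfl)⟩
  have hTJ : ∀ k, k < n → T k ∈ Set.Ico (T 0) (T 0 + 2 * Real.pi) := by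
    intro k hk
    rw [← hTn]
    exact ⟨hTle 0 k (Nat.zero_le k) hk.le, hTmono k n hk le_rfl⟩
  refine ⟨fun i j => ang (code i j), fun i j => ?_, fun i j hij => ⟨?_, ?_, ?_, ?_⟩⟩
  · simp only [ang]
    split_ifs <;> fun_prop
  · have hwrap : Complex.exp ((T n : ℝ) * Complex.I) =
        Complex.exp ((θ ⟨0, hn⟩ : ℝ) * Complex.I) := by
      rw [hTn, hT0, exp_ofReal_add_two_pi_mul_I]
    obtain ⟨m, hm, ⟨e1, -, e3, -⟩ | ⟨e1, -, -, e4⟩⟩ := hcode i j hij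
    · simp only [e1, ang, if_true, zero_mul, add_zero]
      rw [← hT i, e3]
    · simp only [e1, ang, Bool.false_eq_true, if_false, zero_mul, sub_zero]
      rcases e4 with e4 | ⟨e4, e5⟩
      · rw [← hT i, e4]
      · rw [e5, hwrap, show i = ⟨0, hn⟩ from Fin.ext e4]
  · obtain ⟨m, hm, ⟨e1, e2, -, -⟩ | ⟨e1, e2, -, -⟩⟩ := hcode i j hij <;>
    · simp only [e1, e2, ang, Bool.false_eq_true, if_false, if_true]
      ring
  · intro t ht k heq
    obtain ⟨m, hm, hc⟩ := hcode i j hij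
    have hk := k.2
    have h1 : ∀ b, code i j = (m, b) → False := by
      intro b hb
      simp only [hb] at heq
      rw [← hT k] at heq
      have h2 := eq_of_exp_mul_I_eq (hangJ m b t hm ht) (hTJ k hk) heq
      have h3 := hangI m b t hm ht
      rw [h2] at h3
      rcases Nat.lt_or_ge m k with h4 | h4
      · exact absurd h3.2 (hTle (m + 1) k h4 hk.le).not_gt
      · exact absurd h3.1 (hTle k m h4 hm.le).not_gt
    rcases hc with ⟨hc, -⟩ | ⟨hc, -⟩ <;> exact h1 _ hc
  · intro i' j' hij' s hs t ht heq
    obtain ⟨m, hm, hc⟩ := hcode i j hij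
    obtain ⟨m', hm', hc'⟩ := hcode i' j' hij'
    have hmm : ∀ b b', code i j = (m, b) → code i' j' = (m', b') →
        m = m' ∧ ang (m, b) s = ang (m', b') t := by
      intro b b' hb hb'
      simp only [hb, hb'] at heq
      have h2 := eq_of_exp_mul_I_eq (hangJ m b s hm hs) (hangJ m' b' t hm' ht) heq
      have h3 := hangI m b s hm hs
      have h4 := hangI m' b' t hm' ht
      rw [h2] at h3
      refine ⟨?_, h2⟩
      rcases lt_trichotomy m m' with h5 | h5 | h5
      · linarith [hTle (m + 1) m' h5 hm'.le, h3.2, h4.1]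
      · exact h5
      · linarith [hTle (m' + 1) m h5 hm.le, h3.1, h4.2]
    have hi := i.2
    have hj := j.2
    have hi' := i'.2
    have hj' := j'.2
    have hs1 := hs.2
    have ht1 := ht.2
    have hpos := hTmono m (m + 1) (Nat.lt_succ_self m) hm
    rcases hc with ⟨c1, -, c2, c3⟩ | ⟨c1, -, c2, c3⟩ <;>
    rcases hc' with ⟨d1, -, d2, d3⟩ | ⟨d1, -, d2, d3⟩ <;>
    obtain ⟨rfl, h2⟩ := hmm _ _ c1 d1 <;>
    simp only [ang, Bool.false_eq_true, if_false, if_true] at h2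
    · refine ⟨?_, Or.inl ⟨Fin.ext (by omega), Fin.ext (by omega)⟩⟩
      exact (mul_right_cancel₀ (by linarith) (add_left_cancel h2)).symm
    · have h3 : (s + t - 2) * ((T (m + 1) - T m) / 2) = 0 := by linear_combination h2
      have h4 : s + t - 2 = 0 := (mul_eq_zero.1 h3).resolve_right (by linarith)
      exact ⟨by linarith, Or.inr ⟨⟨Fin.ext (by omega), Fin.ext (by omega)⟩, by linarith⟩⟩
    · have h3 : (s + t - 2) * ((T (m + 1) - T m) / 2) = 0 := by linear_combination -h2
      have h4 : s + t - 2 = 0 := (mul_eq_zero.1 h3).resolve_right (by linarith)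
      exact ⟨by linarith, Or.inr ⟨⟨Fin.ext (by omega), Fin.ext (by omega)⟩, by linarith⟩⟩
    · refine ⟨?_, Or.inl ⟨Fin.ext (by omega), Fin.ext (by omega)⟩⟩
      have h3 : (t - s) * ((T (m + 1) - T m) / 2) = 0 := by linear_combination h2
      linarith [(mul_eq_zero.1 h3).resolve_right (by linarith)]

/-! ### Circles around the vertices of a drawing -/

namespace HalfEdgeGraph.PlaneEmbedding

variable {V H : Type*} {G : HalfEdgeGraph V H}

open Filter Topology in
/-- An arc that initially runs along a ray in a local picture gives an arm that does so up to some
positive time. -/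
theorem exists_Ioc_arm_of_eventually_arc {D : G.PlaneEmbedding} {h : H} {U : Set ℂ}
    {Φ : ℂ → ℂ} {w : ℂ} (hD : ∀ᶠ t in 𝓝[>] (0 : unitInterval),
      D.arc h t ∈ U ∧ ∃ r : ℝ, 0 < r ∧ Φ (D.arc h t) = (r : ℂ) * w) :
    ∃ ε ∈ Set.Ioc (0 : ℝ) 1, ∀ t ∈ Set.Ioc 0 ε, D.toArmEmbedding.arm h t ∈ U ∧
      ∃ r : ℝ, 0 < r ∧ Φ (D.toArmEmbedding.arm h t) = (r : ℂ) * w := by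
  obtain ⟨u, hu, hsub⟩ := (mem_nhdsGT_iff_exists_Ioo_subset' (zero_lt_one' unitInterval)).1 hD
  have hu0 : (0 : ℝ) < u := hu
  refine ⟨u, ⟨hu0, u.2.2⟩, fun t ht => hsub ?_⟩
  have h1 := ht.1
  have h2 := ht.2
  have h3 := u.2.2
  rw [Set.projIcc_of_mem zero_le_one ⟨by linarith, by linarith⟩]
  exact ⟨Subtype.mk_lt_mk.2 (by linarith), Subtype.coe_lt_coe.1 (by simp only; linarith)⟩

open Topology in
/-- Around a vertex `v` at which the half-edges leave in a given cyclic order there is a closed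
curve `c`, parametrized by an angle, that is met by the arms of the half-edges at `v`, exactly once
and in the given order, and by nothing else: it is a small circle in the local picture at `v`. The
arm of `h` meets it at time `τ h`. -/
theorem LeaveInCyclicOrder.exists_circle [Finite V] [Finite H] {D : G.PlaneEmbedding} {v : V}
    {n : ℕ} {φ : {h : H // G.vert h = v} ≃ Fin n} (hD : D.LeaveInCyclicOrder v φ) {N : Set ℂ}
    (hN : IsOpen N) (hvN : D.point v ∈ N) :
    ∃ (θ : Fin n → ℝ) (c : ℝ → ℂ) (τ : H → ℝ), StrictMono θ ∧
      (∀ i, θ i ∈ Set.Ico 0 (2 * Real.pi)) ∧ Continuous c ∧ (∀ x, c x ∈ N) ∧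
      (∀ x y, c x = c y ↔ Complex.exp (x * Complex.I) = Complex.exp (y * Complex.I)) ∧
      (∀ x w, c x ≠ D.point w) ∧
      (∀ h (hv : G.vert h = v), τ h ∈ Set.Ioo (0 : ℝ) 1 ∧
        D.toArmEmbedding.arm h (τ h) = c (θ (φ ⟨h, hv⟩))) ∧
      ∀ k, ∀ t ∈ Set.Icc (0 : ℝ) 1, ∀ x, D.toArmEmbedding.arm k t = c x →
        ∃ hk : G.vert k = v, t = τ k ∧
          Complex.exp (x * Complex.I) = Complex.exp (θ (φ ⟨k, hk⟩) * Complex.I) := by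
  obtain ⟨Φ, θ, hvs, hv0, hmono, hθ, hray⟩ := hD
  set E := D.toArmEmbedding
  have hEp : E.point = D.point := rfl
  -- up to time `lo h`, the arm of `h` runs along a ray
  have hlo : ∀ h : H, ∃ lo ∈ Set.Icc (0 : ℝ) 1, (0 < lo ∨ G.vert h ≠ v) ∧
      ∀ t ∈ Set.Ioc 0 lo, ∃ hh : G.vert h = v, E.arm h t ∈ Φ.source ∧
        ∃ r : ℝ, 0 < r ∧ Φ (E.arm h t) = (r : ℂ) *
          Complex.exp ((θ (φ ⟨h, hh⟩) : ℂ) * Complex.I) := by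
    intro h
    by_cases hh : G.vert h = v
    · obtain ⟨ε, hε, H⟩ := exists_Ioc_arm_of_eventually_arc (hray ⟨h, hh⟩)
      exact ⟨ε, ⟨hε.1.le, hε.2⟩, Or.inl hε.1, fun t ht => ⟨hh, H t ht⟩⟩
    · exact ⟨0, ⟨le_rfl, zero_le_one⟩, Or.inr hh, fun t ht => absurd (ht.1.trans_le ht.2)
        (lt_irrefl _)⟩
  choose lo hlo01 hlopos hloray using hlo
  -- everything in the drawing except `v` and these initial parts
  let K : Set ℂ := (⋃ h, E.arm h '' Set.Icc (lo h) 1) ∪ D.point '' {w | w ≠ v}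
  have hK : IsClosed K := by
    refine (IsCompact.isClosed ?_)
    exact (isCompact_iUnion fun h => isCompact_Icc.image (E.continuous_arm h)).union
      (Set.toFinite _).isCompact
  have hvK : D.point v ∉ K := by
    rintro (hv | ⟨w, hw, e⟩)
    · obtain ⟨h, t, ht, e⟩ := Set.mem_iUnion.1 hv
      rcases ((hlo01 h).1.trans ht.1).eq_or_lt with h0 | h0
      · subst h0
        rw [E.arm_zero] at e
        have h1 : lo h = 0 := le_antisymm ht.1 (hlo01 h).1
        rcases hlopos h with h2 | h2
        · exact h2.ne' h1
        · exact h2 (D.point_injective e)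
      · exact E.arm_ne_point h v t ⟨h0, ht.2⟩ e
    · exact hw (D.point_injective e)
  let U : Set ℂ := Kᶜ ∩ N ∩ Φ.source
  have hU : IsOpen U := (hK.isOpen_compl.inter hN).inter Φ.open_source
  have hUs : U ⊆ Φ.source := Set.inter_subset_right
  have hΦU : IsOpen (Φ '' U) := Φ.isOpen_image_of_subset_source hU hUs
  obtain ⟨ρ, hρ, hball⟩ := Metric.nhds_basis_closedBall.mem_iff.1
    (hΦU.mem_nhds ⟨D.point v, ⟨⟨hvK, hvN⟩, hvs⟩, hv0⟩)
  have hΦ : ∀ z, ‖z‖ ≤ ρ → z ∈ Φ.target ∧ Φ.symm z ∈ U := by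
    intro z hz
    obtain ⟨u, hu, rfl⟩ := hball (mem_closedBall_zero_iff.2 hz)
    exact ⟨Φ.map_source (hUs hu), by rwa [Φ.left_inv (hUs hu)]⟩
  have hρc : (ρ : ℂ) ≠ 0 := by exact_mod_cast hρ.ne'
  have hnorm : ∀ r : ℝ, 0 < r → ∀ x : ℝ, ‖(r : ℂ) * Complex.exp ((x : ℂ) * Complex.I)‖ = r := by
    intro r hr x
    rw [norm_mul, Complex.norm_exp_ofReal_mul_I, mul_one, Complex.norm_real, Real.norm_eq_abs,
      abs_of_pos hr]
  let c : ℝ → ℂ := fun x => Φ.symm ((ρ : ℂ) * Complex.exp ((x : ℂ) * Complex.I))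
  have hcU : ∀ x, c x ∈ U := fun x => (hΦ _ (hnorm ρ hρ x).le).2
  have hΦc : ∀ x, Φ (c x) = (ρ : ℂ) * Complex.exp ((x : ℂ) * Complex.I) := fun x =>
    Φ.right_inv (hΦ _ (hnorm ρ hρ x).le).1
  have hcne : ∀ x w, c x ≠ D.point w := by
    intro x w h
    by_cases hw : w = v
    · have h1 := hΦc x
      rw [h, hw, hv0] at h1
      exact mul_ne_zero hρc (Complex.exp_ne_zero _) h1.symm
    · exact (hcU x).1.1 (Or.inr ⟨w, hw, h.symm⟩)
  -- the crossing times, by the intermediate value theorem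
  have hτ : ∀ h : H, ∃ τ : ℝ, ∀ hh : G.vert h = v, τ ∈ Set.Ioo (0 : ℝ) 1 ∧
      E.arm h τ = c (θ (φ ⟨h, hh⟩)) := by
    intro h
    by_cases hh : G.vert h = v
    swap
    · exact ⟨0, fun h' => absurd h' hh⟩
    have hpos : 0 < lo h := (hlopos h).resolve_right (not_not.2 hh)
    have hsrc : ∀ t ∈ Set.Icc 0 (lo h), E.arm h t ∈ Φ.source := by
      intro t ht
      rcases ht.1.eq_or_lt with rfl | h0
      · rw [E.arm_zero, hh]
        exact hvs
      · obtain ⟨_, h1, _⟩ := hloray h t ⟨h0, ht.2⟩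
        exact h1
    have hcont : ContinuousOn (fun t => ‖Φ (E.arm h t)‖) (Set.Icc 0 (lo h)) :=
      (Φ.continuousOn.comp (E.continuous_arm h).continuousOn hsrc).norm
    have h0 : ‖Φ (E.arm h 0)‖ = 0 := by
      rw [E.arm_zero, hh, hEp, hv0, norm_zero]
    have h1 : ρ < ‖Φ (E.arm h (lo h))‖ := by
      by_contra! hle
      have h2 := (hΦ _ hle).2
      rw [Φ.left_inv (hsrc _ ⟨hpos.le, le_rfl⟩)] at h2
      exact h2.1.1 (Or.inl (Set.mem_iUnion.2 ⟨h, lo h, ⟨le_rfl, (hlo01 h).2⟩, rfl⟩))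
    obtain ⟨τ, hτ1, hτ2⟩ := intermediate_value_Icc hpos.le hcont
      (show ρ ∈ Set.Icc _ _ from ⟨by simp only [h0]; exact hρ.le, h1.le⟩)
    simp only at hτ2
    have hτ0 : 0 < τ := lt_of_le_of_ne hτ1.1 (by rintro rfl; rw [h0] at hτ2; exact hρ.ne hτ2)
    have hτlo : τ < lo h := lt_of_le_of_ne hτ1.2 (by rintro rfl; exact h1.ne' hτ2)
    refine ⟨τ, fun _ => ⟨⟨hτ0, hτlo.trans_le (hlo01 h).2⟩, ?_⟩⟩
    obtain ⟨_, h3, r, hr, h4⟩ := hloray h τ ⟨hτ0, hτlo.le⟩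
    rw [h4, hnorm r hr] at hτ2
    rw [← Φ.left_inv h3, h4, hτ2]
  choose τ hτ using hτ
  refine ⟨θ, c, τ, hmono, hθ, ?_, fun x => (hcU x).1.2, ?_, hcne, hτ, ?_⟩
  · exact Φ.continuousOn_symm.comp_continuous (by fun_prop) fun x => (hΦ _ (hnorm ρ hρ x).le).1
  · intro x y
    constructor
    · intro h
      have h1 := congrArg Φ h
      rw [hΦc, hΦc] at h1
      exact mul_left_cancel₀ hρc h1
    · intro h
      simp only [c, h]
  · intro k t ht x heq
    have h1 : t < lo k := by
      by_contra! hle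
      exact (hcU x).1.1 (Or.inl (Set.mem_iUnion.2 ⟨k, t, ⟨hle, ht.2⟩, heq⟩))
    have h2 : 0 < t := by
      refine lt_of_le_of_ne ht.1 ?_
      rintro rfl
      exact hcne x _ (heq.symm.trans (E.arm_zero k))
    obtain ⟨hk, h3, r, hr, h4⟩ := hloray k t ⟨h2, h1.le⟩
    rw [heq, hΦc] at h4
    have h5 : ρ = r := by rw [← hnorm ρ hρ x, h4, hnorm r hr]
    rw [← h5] at h4
    have h6 := mul_left_cancel₀ hρc h4
    refine ⟨hk, ?_, h6⟩
    obtain ⟨h7, h8⟩ := hτ k hk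
    have h9 : E.arm k (τ k) = E.arm k t := by
      rw [h8, heq]
      simp only [c, h6]
    exact (E.arm_inj k k _ ⟨h7.1, h7.2.le⟩ _ ⟨h2, ht.2⟩ h9).1

end HalfEdgeGraph.PlaneEmbedding

/-! ### From a drawing of the graph to a drawing of the web graph -/

namespace StarGraph

open HalfEdgeGraph

variable {V H : Type*} {G : StarGraph V H}

/-- Disjoint closed curves `circ v`, parametrized by an angle, around the vertices of a plane
drawing, each met by the drawing only in one point of the arm of each half-edge at `v`. The arm of
`h` meets it at time `time h` and angle `start h`. A dart `d` from `a` to `b` of the given cyclic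
order at `v` comes with a path of angles `rim v d` from `start a` to the middle of an arc of the
curve from `a` to `b`. -/
structure VertexCircles (E : G.toHalfEdgeGraph.ArmEmbedding) where
  circ : V → ℝ → ℂ
  time : H → ℝ
  start : H → ℝ
  rim : (v : V) → (G.adj v).Dart → ℝ → ℝ
  continuous_circ : ∀ v, Continuous (circ v)
  circ_eq_iff : ∀ v w x y, circ v x = circ w y ↔
    v = w ∧ Complex.exp (x * Complex.I) = Complex.exp (y * Complex.I)
  circ_ne_point : ∀ v x w, circ v x ≠ E.point w
  time_mem : ∀ h, time h ∈ Set.Ioo (0 : ℝ) 1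
  arm_time : ∀ h, E.arm h (time h) = circ (G.vert h) (start h)
  eq_time_of_arm_eq_circ : ∀ h, ∀ t ∈ Set.Icc (0 : ℝ) 1, ∀ v x,
    E.arm h t = circ v x → t = time h
  continuous_rim : ∀ v d, Continuous (rim v d)
  rim_zero : ∀ v d, Complex.exp (rim v d 0 * Complex.I) =
    Complex.exp (start d.fst.1 * Complex.I)
  rim_symm_one : ∀ v d, rim v d.symm 1 = rim v d 1
  rim_ne_start : ∀ v d, ∀ t ∈ Set.Ioc (0 : ℝ) 1, ∀ h, G.vert h = v →
    Complex.exp (rim v d t * Complex.I) ≠ Complex.exp (start h * Complex.I)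
  rim_inj : ∀ v d d', ∀ s ∈ Set.Ioc (0 : ℝ) 1, ∀ t ∈ Set.Ioc (0 : ℝ) 1,
    Complex.exp (rim v d s * Complex.I) = Complex.exp (rim v d' t * Complex.I) →
    t = s ∧ (d' = d ∨ (d' = d.symm ∧ s = 1))

theorem IsCompatible.exists_vertexCircles [Finite V] [Finite H]
    {D : G.toHalfEdgeGraph.PlaneEmbedding} (hD : G.IsCompatible D) :
    Nonempty (VertexCircles D.toArmEmbedding) := by
  choose n φ hφ using hD
  obtain ⟨N, hN, hNd⟩ := (Set.finite_range D.point).t2_separation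
  choose θ c τ hmono hθ hc hcN hcc hcp hτ hτu using fun v =>
    (hφ v).exists_circle (hN (D.point v)).2 (hN (D.point v)).1
  choose A hA hA' using fun v => exists_rimAngles (hmono v) (hθ v)
  have hadj : ∀ v (d : (G.adj v).Dart),
      (SimpleGraph.cycleGraph (n v)).Adj (φ v d.fst) (φ v d.snd) := fun v d =>
    (φ v).map_adj_iff.2 d.adj
  refine ⟨⟨c, fun h => τ (G.vert h) h, fun h => θ _ (φ (G.vert h) ⟨h, rfl⟩),
    fun v d => A v (φ v d.fst) (φ v d.snd), hc, ?_, hcp, fun h => (hτ _ h rfl).1,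
    fun h => (hτ _ h rfl).2, ?_, fun v d => hA v _ _, ?_, ?_, ?_, ?_⟩⟩
  · intro v w x y
    constructor
    · intro h
      have hvw : v = w := by
        by_contra hne
        exact Set.disjoint_left.1 (hNd ⟨v, rfl⟩ ⟨w, rfl⟩ (D.point_injective.ne hne)) (hcN v x)
          (h ▸ hcN w y)
      subst hvw
      exact ⟨rfl, (hcc v x y).1 h⟩
    · rintro ⟨rfl, h⟩
      exact (hcc v x y).2 h
  · intro h t ht v x heq
    obtain ⟨rfl, h1, -⟩ := hτu v h t ht x heq
    exact h1
  · rintro v d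
    obtain ⟨⟨⟨a, rfl⟩, b⟩, hab⟩ := d
    exact (hA' _ _ _ (hadj _ ⟨⟨⟨a, rfl⟩, b⟩, hab⟩)).1
  · intro v d
    exact (hA' v _ _ (hadj v d)).2.1.symm
  · rintro v d t ht h rfl
    exact (hA' _ _ _ (hadj _ d)).2.2.1 t ht _
  · intro v d d' s hs t ht heq
    obtain ⟨h1, h2⟩ := (hA' v _ _ (hadj v d)).2.2.2 _ _ (hadj v d') s hs t ht heq
    refine ⟨h1, h2.imp (fun h => ?_) (fun h => ⟨?_, h.2⟩)⟩
    · exact SimpleGraph.Dart.ext _ _ (Prod.ext ((φ v).injective h.1) ((φ v).injective h.2))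
    · exact SimpleGraph.Dart.ext _ _ (Prod.ext ((φ v).injective h.1.1) ((φ v).injective h.1.2))

namespace VertexCircles

variable {E : G.toHalfEdgeGraph.ArmEmbedding} (C : VertexCircles E)

/-- The vertices of the web graph: those of the graph, and the points where the arms cross the
closed curves. -/
def webPoint : V ⊕ H → ℂ
  | .inl v => E.point v
  | .inr h => E.arm h (C.time h)

/-- The arms of the web graph: parts of the arms of the graph, and arcs of the closed curves. -/
noncomputable def webArm : G.WebHalfEdge → ℝ → ℂ
  | .out h, t => E.arm h (t * (C.time h / 2))
  | .into h, t => E.arm h (C.time h - t * (C.time h / 2))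
  | .mid h, t => E.arm h (C.time h + t * (1 - C.time h))
  | .rim v d, t => C.circ v (C.rim v d t)

theorem arm_ne_circ (h : H) {t : ℝ} (ht : t ∈ Set.Icc (0 : ℝ) 1) (hne : t ≠ C.time h) (v : V)
    (x : ℝ) : E.arm h t ≠ C.circ v x := fun e => hne (C.eq_time_of_arm_eq_circ h t ht v x e)

theorem arm_time_ne_circ_rim (h : H) (v : V) (d : (G.adj v).Dart) {t : ℝ}
    (ht : t ∈ Set.Ioc (0 : ℝ) 1) : E.arm h (C.time h) ≠ C.circ v (C.rim v d t) := by
  intro e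
  rw [C.arm_time, C.circ_eq_iff] at e
  exact C.rim_ne_start v d t ht h e.1 e.2.symm

theorem out_mem (h : H) {t : ℝ} (ht : t ∈ Set.Ioc (0 : ℝ) 1) :
    0 < t * (C.time h / 2) ∧ t * (C.time h / 2) ≤ C.time h / 2 := by
  have h1 := (C.time_mem h).1
  have h2 := ht.1
  have h3 := ht.2
  exact ⟨by positivity, by nlinarith⟩

theorem mid_mem (h : H) {t : ℝ} (ht : t ∈ Set.Ioc (0 : ℝ) 1) :
    C.time h < C.time h + t * (1 - C.time h) ∧ C.time h + t * (1 - C.time h) ≤ 1 := by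
  have h1 := (C.time_mem h).2
  have h2 := ht.1
  have h3 := ht.2
  exact ⟨by nlinarith, by nlinarith⟩

theorem continuous_webArm (x : G.WebHalfEdge) : Continuous (C.webArm x) := by
  rcases x with h | h | h | ⟨v, d⟩
  · exact (E.continuous_arm h).comp (by fun_prop : Continuous fun t => t * (C.time h / 2))
  · exact (E.continuous_arm h).comp
      (by fun_prop : Continuous fun t => C.time h - t * (C.time h / 2))
  · exact (E.continuous_arm h).comp
      (by fun_prop : Continuous fun t => C.time h + t * (1 - C.time h))
  · exact (C.continuous_circ v).comp (C.continuous_rim v d)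

/-- At positive times, an arm of the web graph that is a part of an arm of the graph avoids the new
vertex on it. -/
theorem webArm_cases (x : G.WebHalfEdge) {t : ℝ} (ht : t ∈ Set.Ioc (0 : ℝ) 1) :
    (∃ h, ∃ u ∈ Set.Ioc (0 : ℝ) 1, u ≠ C.time h ∧ C.webArm x t = E.arm h u) ∨
      ∃ v d, x = .rim v d := by
  rcases x with h | h | h | ⟨v, d⟩
  · have h1 := C.out_mem h ht
    have h2 := C.time_mem h
    exact Or.inl ⟨h, _, ⟨h1.1, by linarith [h2.2, h2.1]⟩, by linarith [h2.1], rfl⟩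
  · have h1 := C.out_mem h ht
    have h2 := C.time_mem h
    exact Or.inl ⟨h, _, ⟨by linarith [h2.1], by linarith [h2.2]⟩, by linarith, rfl⟩
  · have h1 := C.mid_mem h ht
    have h2 := C.time_mem h
    exact Or.inl ⟨h, _, ⟨by linarith [h2.1], h1.2⟩, h1.1.ne', rfl⟩
  · exact Or.inr ⟨v, d, rfl⟩

theorem webArm_ne_webPoint (x : G.WebHalfEdge) (w : V ⊕ H) {t : ℝ}
    (ht : t ∈ Set.Ioc (0 : ℝ) 1) : C.webArm x t ≠ C.webPoint w := by
  rcases C.webArm_cases x ht with ⟨h, u, hu, hne, e⟩ | ⟨v, d, rfl⟩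
  · rw [e]
    rcases w with w | k
    · exact E.arm_ne_point h w u hu
    · intro heq
      have hk := C.time_mem k
      obtain ⟨h1, rfl | ⟨-, h2⟩⟩ := E.arm_inj h k u hu _ ⟨hk.1, hk.2.le⟩ heq
      · exact hne h1.symm
      · exact hk.2.ne (h1.trans h2)
  · rcases w with w | k
    · exact C.circ_ne_point v _ w
    · exact (C.arm_time_ne_circ_rim k v d ht).symm

theorem webPoint_injective : Function.Injective C.webPoint := by
  have hmem : ∀ h, C.time h ∈ Set.Ioc (0 : ℝ) 1 := fun h =>
    ⟨(C.time_mem h).1, (C.time_mem h).2.le⟩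
  rintro (v | h) (w | k) heq
  · exact congrArg Sum.inl (E.point_injective heq)
  · exact absurd heq.symm (E.arm_ne_point k v _ (hmem k))
  · exact absurd heq (E.arm_ne_point h w _ (hmem h))
  · rcases (E.arm_inj h k _ (hmem h) _ (hmem k) heq).2 with e | ⟨-, e⟩
    · rw [e]
    · exact absurd e (C.time_mem h).2.ne

theorem webArm_inj (x y : G.WebHalfEdge) {s t : ℝ} (hs : s ∈ Set.Ioc (0 : ℝ) 1)
    (ht : t ∈ Set.Ioc (0 : ℝ) 1) (heq : C.webArm x s = C.webArm y t) :
    t = s ∧ (y = x ∨ (y = G.webOpp x ∧ s = 1)) := by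
  have mixed : ∀ z v d, ∀ a ∈ Set.Ioc (0 : ℝ) 1, ∀ b, C.webArm z a = C.webArm (.rim v d) b →
      ∃ w e, z = .rim w e := by
    intro z v d a ha b h
    refine (C.webArm_cases z ha).resolve_left ?_
    rintro ⟨k, u, hu, hne, e⟩
    exact C.arm_ne_circ k ⟨hu.1.le, hu.2⟩ hne v _ (e.symm.trans h)
  have key : ∀ h k, ∀ a b : ℝ, 0 < a → a ≤ 1 → 0 < b → b ≤ 1 → E.arm h a = E.arm k b →
      b = a ∧ (k = h ∨ (k = G.opp h ∧ a = 1)) :=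
    fun h k a b h1 h2 h3 h4 e => E.arm_inj h k a ⟨h1, h2⟩ b ⟨h3, h4⟩ e
  have hs1 := hs.2
  have ht1 := ht.2
  rcases x with h | h | h | ⟨v, d⟩ <;> rcases y with k | k | k | ⟨w, e⟩
  case rim.rim =>
    obtain ⟨rfl, h1⟩ := (C.circ_eq_iff _ _ _ _).1 heq
    obtain ⟨h2, h3⟩ := C.rim_inj v d e s hs t ht h1
    refine ⟨h2, h3.imp (fun h => ?_) (fun h => ⟨?_, h.2⟩)⟩
    · rw [h]
    · rw [h.1]
      rfl
  case out.rim | into.rim | mid.rim =>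
    obtain ⟨_, _, h1⟩ := mixed _ _ _ _ hs _ heq
    simp at h1
  case rim.out | rim.into | rim.mid =>
    obtain ⟨_, _, h1⟩ := mixed _ _ _ _ ht _ heq.symm
    simp at h1
  all_goals
    have o1 := C.out_mem h hs
    have o2 := C.out_mem k ht
    have m1 := C.mid_mem h hs
    have m2 := C.mid_mem k ht
    have t1 := C.time_mem h
    have t2 := C.time_mem k
    have t1' := t1.1
    have t1'' := t1.2
    have t2' := t2.1
    have t2'' := t2.2
    simp only [webArm] at heq
    obtain ⟨e1, e2⟩ := key _ _ _ _ (by linarith) (by linarith) (by linarith) (by linarith) heq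
    rcases e2 with rfl | ⟨rfl, e2⟩
  · exact ⟨mul_right_cancel₀ (by linarith) e1, Or.inl rfl⟩
  · linarith
  · have e3 : (2 - s - t) * (C.time k / 2) = 0 := by linear_combination e1
    have e4 := (mul_eq_zero.1 e3).resolve_right (by linarith)
    exact ⟨by linarith, Or.inr ⟨rfl, by linarith⟩⟩
  · linarith
  · linarith
  · linarith
  · have e3 : (2 - s - t) * (C.time k / 2) = 0 := by linear_combination -e1
    have e4 := (mul_eq_zero.1 e3).resolve_right (by linarith)
    exact ⟨by linarith, Or.inr ⟨rfl, by linarith⟩⟩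
  · linarith
  · exact ⟨mul_right_cancel₀ (b := C.time k / 2) (by linarith) (by linarith), Or.inl rfl⟩
  · linarith
  · linarith
  · linarith
  · linarith
  · linarith
  · linarith
  · linarith
  · exact ⟨mul_right_cancel₀ (b := 1 - C.time k) (by linarith) (by linarith), Or.inl rfl⟩
  · have e3 : (1 - s) * (1 - C.time h) = 0 := by linear_combination -e2
    have e4 : (1 - t) * (1 - C.time (G.opp h)) = 0 := by linear_combination -e2 - e1
    have e5 := (mul_eq_zero.1 e3).resolve_right (by linarith)
    have e6 := (mul_eq_zero.1 e4).resolve_right (by linarith)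
    exact ⟨by linarith, Or.inr ⟨rfl, by linarith⟩⟩

/-- The drawing of the web graph. -/
noncomputable def webEmbedding : G.web.ArmEmbedding where
  point := C.webPoint
  arm := C.webArm
  continuous_arm := C.continuous_webArm
  arm_zero := by
    rintro (h | h | h | ⟨v, ⟨⟨⟨a, rfl⟩, b⟩, hab⟩⟩)
    · exact (congrArg (E.arm h) (zero_mul _)).trans (E.arm_zero h)
    · simp [webArm, web, webVert, webPoint]
    · simp [webArm, web, webVert, webPoint]
    · exact ((C.circ_eq_iff _ _ _ _).2 ⟨rfl, C.rim_zero _ _⟩).trans (C.arm_time a).symm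
  arm_opp_one := by
    rintro (h | h | h | ⟨v, d⟩)
    · simp only [webArm, web, webOpp]
      congr 1
      ring
    · simp only [webArm, web, webOpp]
      congr 1
      ring
    · simp only [webArm, web, webOpp, one_mul, add_sub_cancel]
      exact E.arm_opp_one h
    · exact congrArg (C.circ v) (C.rim_symm_one v d)
  point_injective := C.webPoint_injective
  arm_ne_point x w _ ht := C.webArm_ne_webPoint x w ht
  arm_inj x y _ hs _ ht heq := C.webArm_inj x y hs ht heq

end VertexCircles

theorem web_isPlanar_of_isPlanar [Finite V] [Finite H] (hG : G.IsPlanar) : G.web.IsPlanar := by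
  obtain ⟨D, hD⟩ := hG
  obtain ⟨C⟩ := hD.exists_vertexCircles
  exact ⟨C.webEmbedding.toPlaneEmbedding⟩

end StarGraph

theorem mainTheorem3 {V H : Type*} [Finite V] [Finite H] (G : StarGraph V H) :
    G.IsPlanar ↔ G.web.IsPlanar :=
  ⟨StarGraph.web_isPlanar_of_isPlanar, StarGraph.isPlanar_of_web_isPlanar⟩
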